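/- **Proposition.** Let $x^1,x^2\in\mathbb R^2$ be linearly independent with $x^3:=x^1+x^2=(1,0)^T$ and (without loss of generality, exchanging $x^1$ and $x^2$) $x^1_2>0$; write $x^1=(x^1_1,x^1_2)^T$, $\mathbf X=\{x^1,x^2,x^3\}$, and let $\alpha\in\mathbb R_+^3$, i.e. $\alpha_1,\alpha_2,\alpha_3>0$, $|\alpha|=\alpha_1+\alpha_2+\alpha_3$. The fractional cone spline $C_\alpha(\cdot\,|\,\mathbf X)$ is the tempered distribution on $\mathbb R^2$ with Fourier transform (convention $\hat f(\omega)=\int f(x)e^{-i\langle x,\omega\rangle}dx$) $$\widehat{C_\alpha}(\omega\,|\,\mathbf X)=\prod_{k=1}^3\Big(\frac1{i\langle\omega,x^k\rangle}+\sigma_k\pi\,\delta(\langle\omega,x^k\rangle)\Big)^{\alpha_k},\qquad \sigma_k=1\text{ if }\alpha_k\in\mathbb Z,\quad \sigma_k=0\text{ if }\alpha_k\notin\mathbb Z,$$ where the right-hand side is understood as the boundary value $$\lim_{\varepsilon_1,\varepsilon_2,\varepsilon_3\downarrow0}\ \prod_{k=1}^3\big(\varepsilon_k+i\langle\omega,x^k\rangle\big)^{-\alpha_k}$$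 in the sense of tempered distributions (principal powers, joint limit). For $r\in\mathbb R$ let $r_+^p=r^p$ if $r>0$ and $r_+^p=0$ if $r<0$ (put $0_+^0=1$ and $0_+^p=0$ for $p\neq0$), let ${}_2F_1(a,b;c;z)$ for real $z<1$ be the analytic continuation of the Gauss series along the real axis, and let $1/\Gamma=0$ at $0,-1,-2,\dots$. A product one of whose factors is $r_+^p$ with $r<0$ is read as $0$. Then this limit exists, so that $C_\alpha(\cdot\,|\,\mathbf X)$ is well defined; the series in the third line below converges absolutely; and $C_\alpha(\cdot\,|\,\mathbf X)$ is given by integration against a function, again denoted $C_\alpha(x\,|\,\mathbf X)$ (its product with every Schwartz function is integrable), such that $C_\alpha(x\,|\,\mathbf X)$ equals $\frac1{x^1_2}$ times $$\left\{\begin{array}{ll} \frac{1}{\Gamma(\alpha_1)\Gamma(\alpha_2+\alpha_3)}\Big(\frac{x_2}{x^1_2}\Big)^{\alpha_1-1}\Big(x_1-\frac{x^1_1}{x^1_2}x_2\Big)_+^{\alpha_2+\alpha_3-1}{}_2F_1\Big(1-\alpha_1,\alpha_2;\alpha_2+\alpha_3;-\frac{x_1-\frac{x^1_1}{x^1_2}x_2}{x_2/x^1_2}\Big),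 & x_2>0,\\[2mm] \frac{1}{\Gamma(\alpha_2)\Gamma(\alpha_1+\alpha_3)}\Big(-\frac{x_2}{x^1_2}\Big)^{\alpha_2-1}\Big(x_1-\frac{x^1_1-1}{x^1_2}x_2\Big)_+^{\alpha_1+\alpha_3-1}{}_2F_1\Big(1-\alpha_2,\alpha_1;\alpha_1+\alpha_3;\frac{x_1-\frac{x^1_1-1}{x^1_2}x_2}{x_2/x^1_2}\Big), & x_2<0,\\[2mm] \frac{1}{\Gamma(\alpha_1)\Gamma(\alpha_2)}\Big(\sum_{k=0}^\infty\frac{(-1)^k}{k!\,\Gamma(\alpha_3-k)(\alpha_1+\alpha_2+k-1)}\Big)(x_1)_+^{|\alpha|-2}, & x_2=0\ \text{ and }\ \alpha_1+\alpha_2>1, \end{array}\right.$$ where for $\alpha_1+\alpha_2=1$ the undefined $k=0$ term is omitted in the assertion that the series converges. Moreover $C_\alpha(x\,|\,\mathbf X)=0$ for $x_2=0$, $x_1<0$ and all $\alpha\in\mathbb R_+^3$. These values are the pointwise values of the spline: the function $C_\alpha(\cdot\,|\,\mathbf X)$ is continuous at every $x\in\mathbb R^2$, with the following possible exceptions: the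 ray $\{x_2>0,\ x_1=\frac{x^1_1}{x^1_2}x_2\}$ if $\alpha_2+\alpha_3\le1$; the ray $\{x_2<0,\ x_1=\frac{x^1_1-1}{x^1_2}x_2\}$ if $\alpha_1+\alpha_3\le1$; the ray $\{x_2=0,\ x_1>0\}$ if $\alpha_1+\alpha_2\le1$; and the origin, unless $\alpha_1+\alpha_2>1$, $\alpha_2+\alpha_3\ge1$, $\alpha_1+\alpha_3\ge1$ and $|\alpha|>2$. -/

import Mathlib

open MeasureTheory Filter Topology
open scoped SchwartzMap FourierTransform

noncomputable section

/-- The truncated power `r₊ ^ p`: it is `r ^ p` for `r ≥ 0` and `0` for `r < 0`; in particular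
`r₊ ^ 0` is the Heaviside function. -/
def truncPow (r p : ℝ) : ℝ := if 0 ≤ r then r ^ p else 0

/-- `F` is the analytic continuation of the Gauss series `∑ (a)ₙ (b)ₙ / ((c)ₙ n!) zⁿ` from the
interval `(-1, 1)` to the half-line `(-∞, 1)`, i.e. the restriction of the principal branch of the
hypergeometric function to real arguments below `1`. -/
def IsGaussContinuation (a b c : ℝ) (F : ℝ → ℝ) : Prop :=
  AnalyticOnNhd ℝ F (Set.Iio 1) ∧ ∀ z : ℝ, |z| < 1 → F z = ordinaryHypergeometric a b c z

theorem IsGaussContinuation.eqOn {a b c : ℝ} {F G : ℝ → ℝ} (hF : IsGaussContinuation a b c F)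
    (hG : IsGaussContinuation a b c G) : Set.EqOn F G (Set.Iio 1) := by
  refine hF.1.eqOn_of_preconnected_of_eventuallyEq hG.1 isPreconnected_Iio
    (z₀ := 0) (by simp) ?_
  filter_upwards [Metric.ball_mem_nhds (0 : ℝ) one_pos] with z hz
  have hz' : |z| < 1 := by simpa [Metric.mem_ball, Real.dist_eq] using hz
  rw [hF.2 z hz', hG.2 z hz']

open Classical in
/-- The Gauss hypergeometric function `₂F₁(a, b; c; z)` for real `z < 1`, by analytic
continuation of the Gauss series (Mathlib's `ordinaryHypergeometric` is only the sum of the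
series, which diverges for `z < -1`). -/
def gaussHypergeometric (a b c z : ℝ) : ℝ :=
  if h : ∃ F : ℝ → ℝ, IsGaussContinuation a b c F then
    (if z < 1 then h.choose z else 0) else 0

/-- The family `∏ₖ (εₖ + i ⟨ω, xᵏ⟩) ^ (-αₖ)`, `εₖ > 0` (principal powers, on the right half
plane), regularising the symbol `∏ₖ (1 / (i ⟨ω, xᵏ⟩) + σₖ π δ(⟨ω, xᵏ⟩)) ^ αₖ`. -/
def coneSymbolReg {n s : ℕ} (X : Fin n → EuclideanSpace ℝ (Fin s)) (α ε : Fin n → ℝ)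
    (ω : EuclideanSpace ℝ (Fin s)) : ℂ :=
  ∏ k, ((ε k : ℂ) + Complex.I * ((inner ℝ ω (X k) : ℝ) : ℂ)) ^ (-(α k : ℂ))

/-- `T` is the fractional cone spline `C_α(· | X)`: it is the tempered distribution whose Fourier
transform is the boundary value, as all `εₖ` tend to `0` from above, of `coneSymbolReg`.

In each factor this is the usual meaning of `(1 / (iω) + σ π δ(ω)) ^ α`: by the
Sokhotski-Plemelj formula `lim (ε + iω)⁻¹ = p.v. 1 / (iω) + π δ(ω)`, with powers taken as powers of
boundary values when `α` is an integer (`σ = 1`), while for non-integral `α` (`σ = 0`) the limit of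
`(ε + iω) ^ (-α)` is the canonical regularisation of the function `(iω) ^ (-α)`, which is that
function itself when `α < 1`.

The angular frequency is `ω = 2 π ξ`, because Mathlib's Fourier transform
`∫ f(x) exp (-2 π i ⟨x, ξ⟩) dx` is at `ξ` what the transform `∫ f(x) exp (-i ⟨x, ω⟩) dx` is
at `2 π ξ`. -/
def IsFracConeSpline {n s : ℕ} (X : Fin n → EuclideanSpace ℝ (Fin s)) (α : Fin n → ℝ)
    (T : 𝓢'(EuclideanSpace ℝ (Fin s), ℂ)) : Prop :=
  ∀ g : 𝓢(EuclideanSpace ℝ (Fin s), ℂ),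
    Tendsto (fun ε : Fin n → ℝ => ∫ ξ, g ξ * coneSymbolReg X α ε ((2 * Real.pi) • ξ))
      (𝓝[{ε | ∀ k, 0 < ε k}] 0) (𝓝 ((𝓕 T) g))

theorem IsFracConeSpline.unique {n s : ℕ} {X : Fin n → EuclideanSpace ℝ (Fin s)}
    {α : Fin n → ℝ} {T T' : 𝓢'(EuclideanSpace ℝ (Fin s), ℂ)}
    (h : IsFracConeSpline X α T) (h' : IsFracConeSpline X α T') : T = T' := by
  have hne : (𝓝[{ε : Fin n → ℝ | ∀ k, 0 < ε k}] 0).NeBot := by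
    rw [← mem_closure_iff_nhdsWithin_neBot]
    have hs : {ε : Fin n → ℝ | ∀ k, 0 < ε k} = Set.univ.pi fun _ => Set.Ioi 0 := by
      ext; simp
    rw [hs, closure_pi_set]
    simp only [closure_Ioi, Set.mem_pi, Set.mem_univ, Set.mem_Ici, Pi.zero_apply, le_refl,
      implies_true]
  have key : 𝓕 T = 𝓕 T' := by
    ext g
    exact tendsto_nhds_unique (h g) (h' g)
  have := congrArg (fun S => 𝓕⁻ S) key
  simpa using this

open Classical in
/-- The fractional cone spline `C_α(· | X)` of order `α` with knots `X`. -/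
def fracConeSpline {n s : ℕ} (X : Fin n → EuclideanSpace ℝ (Fin s)) (α : Fin n → ℝ) :
    𝓢'(EuclideanSpace ℝ (Fin s), ℂ) :=
  if h : ∃ T, IsFracConeSpline X α T then h.choose else 0

/-- The tempered distribution `T` is (integration against) the function `f`. -/
def IsRepresentedBy {s : ℕ} (T : 𝓢'(EuclideanSpace ℝ (Fin s), ℂ))
    (f : EuclideanSpace ℝ (Fin s) → ℝ) : Prop :=
  ∀ g : 𝓢(EuclideanSpace ℝ (Fin s), ℂ),
    Integrable (fun x => g x * (f x : ℂ)) ∧ T g = ∫ x, g x * (f x : ℂ)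

/-- A 3-directional mesh `x¹, x², x³` in the plane. -/
def IsThreeDirectionalMesh (X : Fin 3 → EuclideanSpace ℝ (Fin 2)) : Prop :=
  LinearIndependent ℝ ![X 0, X 1] ∧ X 2 = X 0 + X 1

end

/-!
For `a > 0` and `0 < re r`, the power `r ^ (-a)` is the Laplace transform of the Gamma weight
`t ^ (a - 1) / Γ(a) dt` on the half-line (`integral_exp_gammaWeight`). Hence, by Fubini, the
regularised symbol paired with a Schwartz function `g` is the integral of `𝓕 g (∑ tₖ xᵏ)` over the
positive orthant against the product of the Gamma weights, damped by `exp (-∑ εₖ tₖ)`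
(`integral_mul_coneSymbolReg`). The mesh spans a pointed cone, so `𝓕 g (∑ tₖ xᵏ)` is integrable
without the damping, and dominated convergence shows that the limit exists and that the spline is
the push-forward of the product of the Gamma weights under `t ↦ ∑ tₖ xᵏ`
(`isFracConeSpline_coneMeasure`).

In the coordinates `x = s x¹ + u x²` this push-forward has, up to the Jacobian factor `1 / q` with
`q = x¹₂`, the density
`(Γ(a) Γ(b) Γ(c))⁻¹ ∫ (s - t) ^ (a - 1) (u - t) ^ (b - 1) t ^ (c - 1) dt` over `0 < t < min s u`
(`lintegral_gammaWeight_shear`). For `0 < u < s` the substitution `t = u (1 - τ)` turns it into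
`u ^ (b + c - 1) ∫₀¹ τ ^ (b - 1) (1 - τ) ^ (c - 1) (s - u + u τ) ^ (a - 1) dτ`, which is Euler's
integral for the Gauss hypergeometric function (`gaussHypergeometric_eq_eulerIntegral`); the sector
`s < u` follows by exchanging `x¹` and `x²`. On the line `s = u` the integral is the Beta integral
`B(a + b - 1, c)`, and expanding `(1 - τ) ^ (c - 1)` in a binomial series gives the series of the
theorem (`tsum_centralTerm`). The series converges absolutely because the moduli of the binomial
coefficients `aₖ` eventually decrease with `|aₖ| - |aₖ₊₁| = c / (k + 1) * |aₖ|`, so that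
`∑ |aₖ| / (k + 1)` telescopes (`summable_abs_binomCoeff_div`).

For continuity, `τ s ≤ s - u + u τ ≤ s` bounds the power `(s - u + u τ) ^ (a - 1)` by
`s ^ (a - 1) (1 + τ ^ (a - 1))`, whose product with the weight is integrable when `a + b > 1`. A
bound of this kind gives the limit on the central ray by dominated convergence
(`tendsto_sectorValue`), and at the apex it bounds the spline by a multiple of
`s ^ (a + b + c - 2)` (`exists_sectorValue_le`).
-/

/-! ### Beta integrals -/

/-- A real power on a positive interval is bounded by the sum of its values at the endpoints,
whatever the sign of the exponent. -/
theorem rpow_le_rpow_add_rpow {m v R p : ℝ} (hm : 0 < m) (h1 : m ≤ v) (h2 : v ≤ R) :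
    v ^ p ≤ m ^ p + R ^ p := by
  have hv : 0 < v := hm.trans_le h1
  have hR : 0 < R := hv.trans_le h2
  rcases le_total 0 p with hp | hp
  · have := Real.rpow_le_rpow hv.le h2 hp
    have := Real.rpow_nonneg hm.le p
    linarith
  · have := Real.rpow_le_rpow_of_nonpos hm h1 hp
    have := Real.rpow_nonneg hR.le p
    linarith

/-- The weight `τ ^ (b - 1) * (1 - τ) ^ (c - 1)` of Euler's Beta integral on `(0, 1)`. -/
noncomputable def betaWeight (b c τ : ℝ) : ℝ := τ ^ (b - 1) * (1 - τ) ^ (c - 1)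

theorem betaWeight_nonneg (b c : ℝ) {τ : ℝ} (h : τ ∈ Set.Ioo (0 : ℝ) 1) :
    0 ≤ betaWeight b c τ :=
  mul_nonneg (Real.rpow_nonneg h.1.le _) (Real.rpow_nonneg (by linarith [h.2]) _)

theorem measurable_betaWeight (b c : ℝ) : Measurable (betaWeight b c) := by
  unfold betaWeight; fun_prop

theorem ofReal_betaWeight {b c τ : ℝ} (h : τ ∈ Set.Ioo (0 : ℝ) 1) :
    ((betaWeight b c τ : ℝ) : ℂ) = (τ : ℂ) ^ ((b : ℂ) - 1) * (1 - (τ : ℂ)) ^ ((c : ℂ) - 1) := by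
  rw [betaWeight, Complex.ofReal_mul, Complex.ofReal_cpow h.1.le,
    Complex.ofReal_cpow (by linarith [h.2])]
  push_cast
  rfl

theorem integrableOn_betaWeight {b c : ℝ} (hb : 0 < b) (hc : 0 < c) :
    IntegrableOn (betaWeight b c) (Set.Ioo 0 1) := by
  have h := Complex.betaIntegral_convergent (u := b) (v := c) (by simpa) (by simpa)
  rw [intervalIntegrable_iff_integrableOn_Ioo_of_le zero_le_one] at h
  have h2 : IntegrableOn (fun τ => ((betaWeight b c τ : ℝ) : ℂ)) (Set.Ioo 0 1) :=
    h.congr_fun (fun τ hτ => (ofReal_betaWeight hτ).symm) measurableSet_Ioo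
  have h3 := h2.re
  simpa using! h3

theorem integral_betaWeight {b c : ℝ} (hb : 0 < b) (hc : 0 < c) :
    ∫ τ in Set.Ioo (0 : ℝ) 1, betaWeight b c τ =
      Real.Gamma b * Real.Gamma c / Real.Gamma (b + c) := by
  have h := Complex.betaIntegral_eq_Gamma_mul_div b c (by simpa) (by simpa)
  rw [Complex.betaIntegral, intervalIntegral.integral_of_le zero_le_one,
    integral_Ioc_eq_integral_Ioo,
    ← setIntegral_congr_fun measurableSet_Ioo (fun τ hτ => ofReal_betaWeight hτ),
    integral_complex_ofReal] at h
  rw [← Complex.ofReal_add] at h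
  simp only [Complex.Gamma_ofReal] at h
  exact_mod_cast h

theorem betaWeight_mul_pow (b c : ℝ) {τ : ℝ} (h : τ ∈ Set.Ioo (0 : ℝ) 1) (n : ℕ) :
    betaWeight b c τ * τ ^ n = betaWeight (b + n) c τ := by
  have := Real.rpow_add_natCast h.1.ne' (b - 1) n
  rw [betaWeight, betaWeight, show b + (n : ℝ) - 1 = b - 1 + n by ring, this]
  ring

/-! ### The Gauss hypergeometric function as an Euler integral -/

/-- The coefficient `(A)ₙ / n!` of `xⁿ` in the binomial series of `(1 - x) ^ (-A)`. -/
noncomputable def binomCoeff (A : ℝ) (n : ℕ) : ℝ := (ascPochhammer ℝ n).eval A / n.factorial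

theorem ascPochhammer_eval_succ_right (A : ℝ) (n : ℕ) :
    (ascPochhammer ℝ (n + 1)).eval A = (ascPochhammer ℝ n).eval A * (A + n) := by
  rw [ascPochhammer_succ_right]; simp

theorem hasSum_binomCoeff (A : ℝ) {x : ℝ} (hx : |x| < 1) :
    HasSum (fun n => binomCoeff A n * x ^ n) ((1 - x) ^ (-A)) := by
  have h := (Real.one_div_one_sub_rpow_hasFPowerSeriesOnBall_zero A).hasSum (y := x)
    (by simpa [enorm_eq_nnnorm, ← NNReal.coe_lt_coe] using hx)
  have h1 : 0 ≤ 1 - x := by linarith [(abs_lt.1 hx).2]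
  simp only [zero_add, one_div, ← Real.rpow_neg h1] at h
  convert! h using 2 with n
  rw [FormalMultilinearSeries.ofScalars_apply_eq, ← Ring.multichoose_eq, smul_eq_mul]
  congr 1
  have h2 := Ring.factorial_nsmul_multichoose_eq_ascPochhammer A n
  rw [Polynomial.ascPochhammer_smeval_eq_eval, nsmul_eq_mul] at h2
  rw [binomCoeff, ← h2, mul_div_cancel_left₀]
  exact_mod_cast n.factorial_ne_zero

theorem Gamma_add_nat_eq {b : ℝ} (hb : 0 < b) (n : ℕ) :
    Real.Gamma (b + n) = (ascPochhammer ℝ n).eval b * Real.Gamma b := by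
  induction n with
  | zero => simp
  | succ n ih =>
    rw [Nat.cast_succ, ← add_assoc, Real.Gamma_add_one (by positivity), ih,
      ascPochhammer_eval_succ_right]
    ring

/-- Euler's integral `∫₀¹ τ ^ (b - 1) (1 - τ) ^ (c - 1) (1 - z τ) ^ (-A) dτ`. -/
noncomputable def eulerIntegral (A b c z : ℝ) : ℝ :=
  ∫ τ in Set.Ioo (0 : ℝ) 1, betaWeight b c τ * (1 - z * τ) ^ (-A)

theorem eulerIntegral_eq_ordinaryHypergeometric (A : ℝ) {b c z : ℝ} (hb : 0 < b) (hc : 0 < c)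
    (hz : |z| < 1) :
    eulerIntegral A b c z = Real.Gamma b * Real.Gamma c / Real.Gamma (b + c) *
      ordinaryHypergeometric A b (b + c) z := by
  have hw := integrableOn_betaWeight hb hc
  have hsum : Summable fun n => |binomCoeff A n * z ^ n| :=
    (hasSum_binomCoeff A hz).summable.abs
  set F : ℕ → ℝ → ℝ := fun n τ => binomCoeff A n * z ^ n * betaWeight (b + n) c τ with hF
  have hint : ∀ n, IntegrableOn (F n) (Set.Ioo 0 1) := fun n =>
    (integrableOn_betaWeight (by positivity) hc).const_mul _
  have hnorm : Summable fun n => ∫ τ in Set.Ioo (0 : ℝ) 1, ‖F n τ‖ := by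
    refine Summable.of_nonneg_of_le (fun n => integral_nonneg fun _ => norm_nonneg _)
      (fun n => ?_) (hsum.mul_right (∫ τ in Set.Ioo (0 : ℝ) 1, betaWeight b c τ))
    rw [← integral_const_mul]
    refine setIntegral_mono_on (hint n).norm (hw.const_mul _) measurableSet_Ioo fun τ hτ => ?_
    rw [Real.norm_eq_abs, hF]
    simp only
    rw [abs_mul, ← betaWeight_mul_pow b c hτ, abs_mul (betaWeight b c τ),
      abs_of_nonneg (betaWeight_nonneg b c hτ),
      abs_of_nonneg (pow_nonneg hτ.1.le n)]
    refine mul_le_mul_of_nonneg_left ?_ (abs_nonneg _)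
    exact mul_le_of_le_one_right (betaWeight_nonneg b c hτ) (pow_le_one₀ hτ.1.le hτ.2.le)
  have key := hasSum_integral_of_summable_integral_norm hint hnorm
  have hE : (∫ τ in Set.Ioo (0 : ℝ) 1, ∑' n, F n τ) = eulerIntegral A b c z := by
    refine setIntegral_congr_fun measurableSet_Ioo fun τ hτ => ?_
    have hzτ : |z * τ| < 1 := by
      rw [abs_mul, abs_of_pos hτ.1]
      exact (mul_le_of_le_one_right (abs_nonneg z) hτ.2.le).trans_lt hz
    refine HasSum.tsum_eq ?_
    convert! (hasSum_binomCoeff A hzτ).mul_left (betaWeight b c τ) using 2 with n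
    simp only [hF]
    rw [← betaWeight_mul_pow b c hτ, mul_pow]
    ring
  rw [hE] at key
  rw [← key.tsum_eq, ordinaryHypergeometric_eq_tsum, ← tsum_mul_left]
  refine tsum_congr fun n => ?_
  simp only [hF]
  rw [integral_const_mul, integral_betaWeight (by positivity) hc, Gamma_add_nat_eq hb,
    show b + (n : ℝ) + c = b + c + n by ring, Gamma_add_nat_eq (by positivity), binomCoeff,
    smul_eq_mul]
  have h1 := (ascPochhammer_pos n (b + c) (by positivity)).ne'
  have h2 := (Real.Gamma_pos_of_pos (add_pos hb hc)).ne'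
  field_simp

open Complex in
/-- Euler's integral is holomorphic on the half-plane `re z < 1`. -/
theorem differentiableOn_complex_eulerIntegral (A : ℝ) {b c : ℝ} (hb : 0 < b) (hc : 0 < c) :
    DifferentiableOn ℂ (fun z : ℂ => ∫ τ in Set.Ioo (0 : ℝ) 1,
      (betaWeight b c τ : ℂ) * (1 - z * τ) ^ (-(A : ℂ))) {z | z.re < 1} := by
  intro z₀ (hz₀ : z₀.re < 1)
  have hw := integrableOn_betaWeight hb hc
  set r : ℝ := (1 - z₀.re) / 2 with hr
  have hr0 : 0 < r := by rw [hr]; linarith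
  set m : ℝ := min 1 r with hm
  have hm0 : 0 < m := lt_min one_pos hr0
  set R : ℝ := 1 + (‖z₀‖ + r) with hR
  have hre : ∀ z ∈ Metric.ball z₀ r, ∀ τ ∈ Set.Ioo (0 : ℝ) 1, m ≤ (1 - z * τ).re := by
    intro z hz τ hτ
    have h1 : |(z - z₀).re| < r := (abs_re_le_norm _).trans_lt (by simpa [dist_eq] using hz)
    have h2 : z.re < 1 - r := by
      have := (abs_lt.1 h1).2
      rw [sub_re] at this
      have : z₀.re = 1 - 2 * r := by rw [hr]; ring
      linarith
    have h3 : (1 - z * τ).re = (1 - τ) * 1 + τ * (1 - z.re) := by simp; ring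
    have h4 : m ≤ 1 := min_le_left _ _
    have h5 : m ≤ r := min_le_right _ _
    rw [h3]
    nlinarith [hτ.1, hτ.2]
  have hnorm : ∀ z ∈ Metric.ball z₀ r, ∀ τ ∈ Set.Ioo (0 : ℝ) 1,
      m ≤ ‖1 - z * τ‖ ∧ ‖1 - z * τ‖ ≤ R := by
    intro z hz τ hτ
    refine ⟨(hre z hz τ hτ).trans (re_le_norm _), ?_⟩
    have h1 : ‖z‖ ≤ ‖z₀‖ + r := by
      have h2 : ‖z - z₀‖ < r := by simpa [dist_eq] using hz
      have := norm_add_le z₀ (z - z₀)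
      rw [add_sub_cancel] at this
      linarith
    calc ‖1 - z * τ‖ ≤ ‖(1 : ℂ)‖ + ‖z * τ‖ := norm_sub_le _ _
      _ ≤ 1 + ‖z‖ := by
        rw [norm_one, norm_mul, norm_real, Real.norm_of_nonneg hτ.1.le]
        gcongr
        exact mul_le_of_le_one_right (norm_nonneg z) hτ.2.le
      _ ≤ R := by rw [hR]; linarith
  have hbound : ∀ p : ℝ, ∀ z ∈ Metric.ball z₀ r, ∀ τ ∈ Set.Ioo (0 : ℝ) 1,
      ‖(1 - z * τ) ^ (p : ℂ)‖ ≤ m ^ p + R ^ p := by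
    intro p z hz τ hτ
    rw [norm_cpow_real]
    exact rpow_le_rpow_add_rpow hm0 (hnorm z hz τ hτ).1 (hnorm z hz τ hτ).2
  have hmeas : ∀ z p : ℂ, AEStronglyMeasurable
      (fun τ : ℝ => (betaWeight b c τ : ℂ) * (1 - z * τ) ^ p)
      (volume.restrict (Set.Ioo 0 1)) := by
    intro z p
    have := measurable_betaWeight b c
    exact Measurable.aestronglyMeasurable (by fun_prop)
  have hderiv := hasDerivAt_integral_of_dominated_loc_of_deriv_le
    (μ := volume.restrict (Set.Ioo (0 : ℝ) 1)) (x₀ := z₀) (s := Metric.ball z₀ r)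
    (F := fun z τ => (betaWeight b c τ : ℂ) * (1 - z * τ) ^ (-(A : ℂ)))
    (F' := fun z τ => (betaWeight b c τ : ℂ) * (1 - z * τ) ^ (-(A : ℂ) - 1) * (A * τ))
    (bound := fun τ => betaWeight b c τ * ((m ^ (-A - 1) + R ^ (-A - 1)) * |A|))
    (Metric.ball_mem_nhds z₀ hr0) (Eventually.of_forall fun z => hmeas z _) ?_ ?_ ?_ ?_ ?_
  · exact hderiv.2.differentiableAt.differentiableWithinAt
  · refine Integrable.mono' (hw.mul_const (m ^ (-A) + R ^ (-A))) (hmeas _ _) ?_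
    filter_upwards [ae_restrict_mem measurableSet_Ioo] with τ hτ
    rw [norm_mul, norm_real, Real.norm_of_nonneg (betaWeight_nonneg b c hτ)]
    have := hbound (-A) z₀ (Metric.mem_ball_self hr0) τ hτ
    rw [ofReal_neg] at this
    exact mul_le_mul_of_nonneg_left this (betaWeight_nonneg b c hτ)
  · exact (hmeas _ _).mul (Measurable.aestronglyMeasurable (by fun_prop))
  · filter_upwards [ae_restrict_mem measurableSet_Ioo] with τ hτ z hz
    have h0 := betaWeight_nonneg b c hτ
    rw [mul_assoc, norm_mul, norm_real, Real.norm_of_nonneg h0, norm_mul, norm_mul, norm_real,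
      norm_real, Real.norm_eq_abs, Real.norm_of_nonneg hτ.1.le]
    have := hbound (-A - 1) z hz τ hτ
    push_cast at this
    have h3 : |A| * τ ≤ |A| := mul_le_of_le_one_right (abs_nonneg A) hτ.2.le
    have h4 : 0 ≤ |A| * τ := mul_nonneg (abs_nonneg A) hτ.1.le
    exact mul_le_mul_of_nonneg_left
      (mul_le_mul this h3 h4 ((norm_nonneg _).trans this)) h0
  · exact hw.mul_const _
  · filter_upwards [ae_restrict_mem measurableSet_Ioo] with τ hτ z hz
    have hs : 1 - z * τ ∈ slitPlane := Or.inl (hm0.trans_le (hre z hz τ hτ))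
    have h1 : HasDerivAt (fun z : ℂ => 1 - z * τ) (-(τ : ℂ)) z := by
      simpa using ((hasDerivAt_id z).mul_const (τ : ℂ)).const_sub 1
    have h2 := (h1.cpow_const (c := -(A : ℂ)) hs).const_mul (betaWeight b c τ : ℂ)
    convert! h2 using 1
    ring

theorem analyticOnNhd_eulerIntegral (A : ℝ) {b c : ℝ} (hb : 0 < b) (hc : 0 < c) :
    AnalyticOnNhd ℝ (eulerIntegral A b c) (Set.Iio 1) := by
  intro z (hz : z < 1)
  have hopen : IsOpen {z : ℂ | z.re < 1} := isOpen_lt Complex.continuous_re continuous_const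
  have h1 := ((differentiableOn_complex_eulerIntegral A hb hc).analyticOnNhd hopen (z : ℂ)
    (by simpa using hz)).re_ofReal
  refine h1.congr ?_
  filter_upwards [Iio_mem_nhds hz] with x (hx : x < 1)
  have : (∫ τ in Set.Ioo (0 : ℝ) 1, (betaWeight b c τ : ℂ) * (1 - (x : ℂ) * τ) ^ (-(A : ℂ))) =
      ((eulerIntegral A b c x : ℝ) : ℂ) := by
    rw [eulerIntegral, ← integral_complex_ofReal]
    refine setIntegral_congr_fun measurableSet_Ioo fun τ hτ => ?_
    have h2 : 0 ≤ 1 - x * τ := by nlinarith [hτ.1, hτ.2]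
    push_cast [Complex.ofReal_cpow h2]
    rfl
  rw [this, Complex.ofReal_re]

/-- **Euler's integral representation** of the Gauss hypergeometric function on `(-∞, 1)`. -/
theorem gaussHypergeometric_eq_eulerIntegral (A : ℝ) {b c z : ℝ} (hb : 0 < b) (hc : 0 < c)
    (hz : z < 1) :
    gaussHypergeometric A b (b + c) z =
      Real.Gamma (b + c) / (Real.Gamma b * Real.Gamma c) * eulerIntegral A b c z := by
  set F : ℝ → ℝ := fun z =>
    Real.Gamma (b + c) / (Real.Gamma b * Real.Gamma c) * eulerIntegral A b c z with hF
  have hFc : IsGaussContinuation A b (b + c) F := by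
    refine ⟨fun z hz => analyticAt_const.mul (analyticOnNhd_eulerIntegral A hb hc z hz),
      fun z hz => ?_⟩
    simp only [hF]
    rw [eulerIntegral_eq_ordinaryHypergeometric A hb hc hz]
    have h1 := (Real.Gamma_pos_of_pos hb).ne'
    have h2 := (Real.Gamma_pos_of_pos hc).ne'
    have h3 := (Real.Gamma_pos_of_pos (add_pos hb hc)).ne'
    field_simp
  have h : ∃ F, IsGaussContinuation A b (b + c) F := ⟨F, hFc⟩
  rw [gaussHypergeometric, dif_pos h, if_pos hz]
  exact h.choose_spec.eqOn hFc hz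

/-! ### The series on the central ray -/

theorem neg_one_pow_div_Gamma_sub (c : ℝ) (k : ℕ) :
    (-1 : ℝ) ^ k / Real.Gamma (c - k) = (ascPochhammer ℝ k).eval (1 - c) / Real.Gamma c := by
  induction k with
  | zero => simp
  | succ k ih =>
    rw [ascPochhammer_eval_succ_right, mul_div_right_comm, ← ih, Nat.cast_succ,
      show c - ((k : ℝ) + 1) = c - k - 1 by ring]
    rcases eq_or_ne (c - k - 1) 0 with h | h
    · -- both sides vanish: the left-hand one because `Real.Gamma 0 = 0`
      rw [h, show 1 - c + (k : ℝ) = -(c - k - 1) by ring, h]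
      simp
    · have h1 := Real.Gamma_add_one h
      rw [sub_add_cancel] at h1
      rw [h1, pow_succ, show 1 - c + (k : ℝ) = -(c - k - 1) by ring]
      rcases eq_or_ne (Real.Gamma (c - k - 1)) 0 with h2 | h2
      · simp [h2]
      · field_simp

theorem centralTerm_eq (c d : ℝ) (k : ℕ) :
    (-1 : ℝ) ^ k / (k.factorial * Real.Gamma (c - k) * (d + k)) =
      (Real.Gamma c)⁻¹ * (binomCoeff (1 - c) k / (d + k)) := by
  have h := neg_one_pow_div_Gamma_sub c k
  rw [show (-1 : ℝ) ^ k / (k.factorial * Real.Gamma (c - k) * (d + k)) =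
    ((-1 : ℝ) ^ k / Real.Gamma (c - k)) / k.factorial / (d + k) by
      simp only [div_eq_mul_inv, mul_inv]; ring, h, binomCoeff]
  simp only [div_eq_mul_inv]
  ring

theorem binomCoeff_succ (A : ℝ) (n : ℕ) :
    binomCoeff A (n + 1) = binomCoeff A n * ((A + n) / (n + 1)) := by
  rw [binomCoeff, binomCoeff, ascPochhammer_eval_succ_right, Nat.factorial_succ]
  have : (n.factorial : ℝ) ≠ 0 := by exact_mod_cast n.factorial_ne_zero
  push_cast
  field_simp

/-- Beyond the index `c`, the moduli of the binomial coefficients of `(1 - x) ^ (c - 1)` decrease,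
with differences `c / (n + 1)` times the coefficient; so the sum telescopes. -/
theorem summable_abs_binomCoeff_div {c : ℝ} (hc : 0 < c) :
    Summable fun n : ℕ => |binomCoeff (1 - c) n| / (n + 1) := by
  set N := ⌈c⌉₊ with hN
  have hNc : c ≤ N := Nat.le_ceil c
  set u : ℕ → ℝ := fun j => |binomCoeff (1 - c) (j + N)| with hu
  have hstep : ∀ j : ℕ, u j / ((j + N : ℕ) + 1) = c⁻¹ * (u j - u (j + 1)) := by
    intro j
    have h1 : 0 ≤ (1 - c + (j + N : ℕ)) / ((j + N : ℕ) + 1 : ℝ) := by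
      push_cast
      exact div_nonneg (by linarith [(Nat.cast_nonneg j : (0 : ℝ) ≤ j)]) (by positivity)
    simp only [hu]
    rw [show j + 1 + N = j + N + 1 by ring, binomCoeff_succ, abs_mul, abs_of_nonneg h1]
    field_simp
    ring
  rw [← summable_nat_add_iff N]
  refine summable_of_sum_range_le (c := c⁻¹ * u 0) (fun n => by positivity) fun n => ?_
  simp_rw [show ∀ j : ℕ, |binomCoeff (1 - c) (j + N)| / (((j + N : ℕ) : ℝ) + 1) =
    c⁻¹ * (u j - u (j + 1)) from hstep]
  rw [← Finset.mul_sum, Finset.sum_range_sub']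
  have : 0 ≤ u n := abs_nonneg _
  gcongr
  linarith

theorem summable_binomCoeff_div {c : ℝ} (hc : 0 < c) (d : ℝ) :
    Summable fun n : ℕ => binomCoeff (1 - c) n / (d + n) := by
  refine Summable.of_norm_bounded_eventually_nat
    (g := fun n : ℕ => 2 * (|binomCoeff (1 - c) n| / (n + 1)))
    ((summable_abs_binomCoeff_div hc).mul_left 2) ?_
  filter_upwards [eventually_ge_atTop ⌈1 - 2 * d⌉₊] with n hn
  have h1 : 1 - 2 * d ≤ n := Nat.ceil_le.1 hn
  have h2 : (0 : ℝ) ≤ n := n.cast_nonneg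
  have h3 : ((n : ℝ) + 1) / 2 ≤ d + n := by linarith
  have h4 : 0 < d + n := by linarith
  rw [norm_div, Real.norm_eq_abs, Real.norm_of_nonneg h4.le]
  rw [show 2 * (|binomCoeff (1 - c) n| / ((n : ℝ) + 1)) =
    |binomCoeff (1 - c) n| / (((n : ℝ) + 1) / 2) by field_simp]
  gcongr

/-- Integrating the binomial series of `(1 - τ) ^ (c - 1)` against `τ ^ (d - 1)` term by term. -/
theorem tsum_binomCoeff_div {c d : ℝ} (hc : 0 < c) (hd : 0 < d) :
    ∑' n : ℕ, binomCoeff (1 - c) n / (d + n) =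
      Real.Gamma d * Real.Gamma c / Real.Gamma (d + c) := by
  set F : ℕ → ℝ → ℝ := fun n τ => binomCoeff (1 - c) n * betaWeight (d + n) 1 τ with hF
  have hI : ∀ n : ℕ, ∫ τ in Set.Ioo (0 : ℝ) 1, betaWeight (d + n) 1 τ = 1 / (d + n) := by
    intro n
    have hdn : 0 < d + n := by positivity
    rw [integral_betaWeight hdn one_pos, Real.Gamma_one, Real.Gamma_add_one hdn.ne']
    have := (Real.Gamma_pos_of_pos hdn).ne'
    field_simp
  have hint : ∀ n, IntegrableOn (F n) (Set.Ioo 0 1) := fun n =>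
    (integrableOn_betaWeight (by positivity) one_pos).const_mul _
  have hnorm : Summable fun n => ∫ τ in Set.Ioo (0 : ℝ) 1, ‖F n τ‖ := by
    convert! (summable_binomCoeff_div hc d).abs using 2 with n
    have hdn : 0 < d + n := by positivity
    rw [abs_div, abs_of_pos hdn, div_eq_mul_one_div, ← hI n, ← integral_const_mul]
    refine setIntegral_congr_fun measurableSet_Ioo fun τ hτ => ?_
    simp only [hF]
    rw [norm_mul, Real.norm_eq_abs, Real.norm_of_nonneg (betaWeight_nonneg _ _ hτ)]
  have key := hasSum_integral_of_summable_integral_norm hint hnorm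
  have hE : (∫ τ in Set.Ioo (0 : ℝ) 1, ∑' n, F n τ) =
      ∫ τ in Set.Ioo (0 : ℝ) 1, betaWeight d c τ := by
    refine setIntegral_congr_fun measurableSet_Ioo fun τ hτ => ?_
    refine HasSum.tsum_eq ?_
    have h1 := (hasSum_binomCoeff (1 - c) (x := τ)
      (by rw [abs_of_pos hτ.1]; exact hτ.2)).mul_left (betaWeight d 1 τ)
    convert! h1 using 1
    · ext n
      simp only [hF]
      rw [← betaWeight_mul_pow d 1 hτ]
      ring
    · simp [betaWeight]
  rw [hE, integral_betaWeight hd hc] at key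
  rw [← key.tsum_eq]
  refine tsum_congr fun n => ?_
  simp only [hF]
  rw [integral_const_mul, hI, mul_one_div]

theorem summable_centralTerm {c : ℝ} (hc : 0 < c) (d : ℝ) :
    Summable fun k : ℕ => (-1 : ℝ) ^ k / (k.factorial * Real.Gamma (c - k) * (d + k)) := by
  simp_rw [centralTerm_eq]
  exact (summable_binomCoeff_div hc d).mul_left _

theorem tsum_centralTerm {c d : ℝ} (hc : 0 < c) (hd : 0 < d) :
    ∑' k : ℕ, (-1 : ℝ) ^ k / (k.factorial * Real.Gamma (c - k) * (d + k)) =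
      (Real.Gamma c)⁻¹ * ∫ τ in Set.Ioo (0 : ℝ) 1, betaWeight d c τ := by
  simp_rw [centralTerm_eq]
  rw [tsum_mul_left, tsum_binomCoeff_div hc hd, integral_betaWeight hd hc]

/-! ### The Gamma weight and its Laplace transform -/

/-- The measure `t ^ (a - 1) / Γ(a) dt` on the half-line `t > 0`. -/
noncomputable def gammaWeight (a : ℝ) : Measure ℝ :=
  (volume.restrict (Set.Ioi 0)).withDensity
    fun t => ENNReal.ofReal (t ^ (a - 1) / Real.Gamma a)

theorem measurable_gammaWeight_density (a : ℝ) :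
    Measurable fun t : ℝ => ENNReal.ofReal (t ^ (a - 1) / Real.Gamma a) := by fun_prop

instance (a : ℝ) : SigmaFinite (gammaWeight a) :=
  SigmaFinite.withDensity_of_ne_top (Eventually.of_forall fun _ => ENNReal.ofReal_ne_top)

theorem ae_gammaWeight_pos (a : ℝ) : ∀ᵐ t ∂gammaWeight a, 0 < t :=
  (withDensity_absolutelyContinuous _ _).ae_le (ae_restrict_mem measurableSet_Ioi)

section Gamma

variable {a : ℝ} (ha : 0 < a)

include ha

theorem gammaWeight_density_nonneg {t : ℝ} (ht : 0 < t) : 0 ≤ t ^ (a - 1) / Real.Gamma a :=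
  div_nonneg (Real.rpow_nonneg ht.le _) (Real.Gamma_pos_of_pos ha).le

theorem integral_gammaWeight {E : Type*} [NormedAddCommGroup E] [NormedSpace ℝ E] (f : ℝ → E) :
    ∫ t, f t ∂gammaWeight a =
      ∫ t in Set.Ioi (0 : ℝ), (t ^ (a - 1) / Real.Gamma a) • f t := by
  rw [gammaWeight, integral_withDensity_eq_integral_toReal_smul
    (measurable_gammaWeight_density a) (Eventually.of_forall fun _ => ENNReal.ofReal_lt_top)]
  refine setIntegral_congr_fun measurableSet_Ioi fun t ht => ?_
  simp only [ENNReal.toReal_ofReal (gammaWeight_density_nonneg ha ht)]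

theorem integrable_gammaWeight_iff {E : Type*} [NormedAddCommGroup E] [NormedSpace ℝ E]
    (f : ℝ → E) :
    Integrable f (gammaWeight a) ↔
      IntegrableOn (fun t => (t ^ (a - 1) / Real.Gamma a) • f t) (Set.Ioi 0) := by
  rw [gammaWeight, integrable_withDensity_iff_integrable_smul'
    (measurable_gammaWeight_density a) (Eventually.of_forall fun _ => ENNReal.ofReal_lt_top)]
  refine integrable_congr ?_
  filter_upwards [ae_restrict_mem measurableSet_Ioi] with t ht
  rw [ENNReal.toReal_ofReal (gammaWeight_density_nonneg ha ht)]

theorem integral_exp_gammaWeight_real {r : ℝ} (hr : 0 < r) :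
    ∫ t, Real.exp (-(r * t)) ∂gammaWeight a = r ^ (-a) := by
  rw [integral_gammaWeight ha]
  have h := Real.integral_rpow_mul_exp_neg_mul_Ioi ha hr
  simp only [smul_eq_mul, div_mul_eq_mul_div]
  rw [integral_div, h, mul_div_cancel_right₀ _ (Real.Gamma_pos_of_pos ha).ne', one_div,
    Real.inv_rpow hr.le, Real.rpow_neg hr.le]

theorem integrable_exp_gammaWeight {r : ℝ} (hr : 0 < r) :
    Integrable (fun t => Real.exp (-(r * t))) (gammaWeight a) := by
  -- a non-integrable function would have integral `0`
  refine not_imp_comm.1 integral_undef ?_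
  rw [integral_exp_gammaWeight_real ha hr]
  exact (Real.rpow_pos_of_pos hr _).ne'

open Complex in
/-- The Laplace transform of the Gamma weight: both sides are holomorphic for `0 < re r` and agree
for real `r`. -/
theorem integral_exp_gammaWeight {r : ℂ} (hr : 0 < r.re) :
    ∫ t : ℝ, Complex.exp (-(r * t)) ∂gammaWeight a = r ^ (-(a : ℂ)) := by
  set U : Set ℂ := {z | z.re < 0} with hU
  have hset : Set.Iio (0 : ℝ) ⊆ ProbabilityTheory.integrableExpSet id (gammaWeight a) := by
    intro x (hx : x < 0)
    have := integrable_exp_gammaWeight ha (r := -x) (by linarith)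
    simpa [ProbabilityTheory.integrableExpSet] using this
  have hf : AnalyticOnNhd ℂ (ProbabilityTheory.complexMGF id (gammaWeight a)) U := by
    intro z hz
    exact ProbabilityTheory.analyticAt_complexMGF (interior_maximal hset isOpen_Iio hz)
  have hg : AnalyticOnNhd ℂ (fun z : ℂ => (-z) ^ (-(a : ℂ))) U := by
    intro z (hz : z.re < 0)
    exact analyticAt_id.neg.cpow analyticAt_const (Or.inl (by simpa using hz))
  have hconv : IsPreconnected U := (convex_halfSpace_re_lt 0).isPreconnected
  have htend : Tendsto (fun x : ℝ => (x : ℂ)) (𝓝[≠] (-1)) (𝓝[≠] (-1 : ℂ)) := by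
    refine tendsto_nhdsWithin_iff.2 ⟨?_, ?_⟩
    · have := (continuous_ofReal.tendsto (-1 : ℝ)).mono_left (nhdsWithin_le_nhds (s := {-1}ᶜ))
      simpa using this
    · filter_upwards [self_mem_nhdsWithin] with x hx h
      rw [Set.mem_singleton_iff] at h
      exact hx (Set.mem_singleton_iff.2 (by exact_mod_cast h))
  have hfreq : ∃ᶠ z in 𝓝[≠] (-1 : ℂ),
      ProbabilityTheory.complexMGF id (gammaWeight a) z = (-z) ^ (-(a : ℂ)) := by
    refine htend.frequently (Eventually.frequently ?_)
    filter_upwards [nhdsWithin_le_nhds (Iio_mem_nhds (show (-1 : ℝ) < 0 by norm_num))]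
      with x (hx : x < 0)
    rw [ProbabilityTheory.complexMGF_ofReal, ProbabilityTheory.mgf]
    have h := integral_exp_gammaWeight_real ha (r := -x) (by linarith)
    simp only [neg_mul, neg_neg] at h
    simp only [id_eq]
    rw [h, ofReal_cpow (by linarith)]
    push_cast
    rfl
  have key := hf.eqOn_of_preconnected_of_frequently_eq hg hconv (z₀ := -1)
    (by simp [hU]) hfreq (x := -r) (by simpa [hU] using hr)
  simpa [ProbabilityTheory.complexMGF] using key

theorem gammaWeight_hasTemperateGrowth : (gammaWeight a).HasTemperateGrowth := by
  obtain ⟨n, hn⟩ := exists_nat_gt a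
  refine ⟨n, ?_⟩
  rw [integrable_gammaWeight_iff ha, ← Set.Ioc_union_Ioi_eq_Ioi zero_le_one]
  have hmeas : ∀ s : Set ℝ, AEStronglyMeasurable
      (fun t : ℝ => (t ^ (a - 1) / Real.Gamma a) • (1 + ‖t‖) ^ (-(n : ℝ)))
      (volume.restrict s) := fun s => Measurable.aestronglyMeasurable (by fun_prop)
  refine IntegrableOn.union ?_ ?_
  · have h := intervalIntegral.intervalIntegrable_rpow' (a := 0) (b := 1)
      (show -1 < a - 1 by linarith)
    rw [intervalIntegrable_iff_integrableOn_Ioc_of_le zero_le_one] at h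
    refine Integrable.mono' (h.div_const (Real.Gamma a)) (hmeas _) ?_
    filter_upwards [ae_restrict_mem measurableSet_Ioc] with t ht
    have h0 := gammaWeight_density_nonneg ha ht.1
    rw [norm_smul, Real.norm_of_nonneg h0, Real.norm_of_nonneg (by positivity)]
    exact mul_le_of_le_one_right h0
      (Real.rpow_le_one_of_one_le_of_nonpos (by linarith [norm_nonneg t])
        (neg_nonpos.2 n.cast_nonneg))
  · have h := (integrableOn_Ioi_rpow_of_lt (show a - 1 - n < -1 by linarith) one_pos).div_const
      (Real.Gamma a)
    refine Integrable.mono' h (hmeas _) ?_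
    filter_upwards [ae_restrict_mem measurableSet_Ioi] with t (ht : 1 < t)
    have ht0 : 0 < t := by linarith
    have h0 := gammaWeight_density_nonneg ha ht0
    rw [norm_smul, Real.norm_of_nonneg h0, Real.norm_of_nonneg (by positivity),
      sub_eq_add_neg (a - 1) (n : ℝ),
      Real.rpow_add ht0, mul_div_right_comm]
    refine mul_le_mul_of_nonneg_left (Real.rpow_le_rpow_of_nonpos ht0 ?_
      (neg_nonpos.2 n.cast_nonneg)) h0
    linarith [le_abs_self t, Real.norm_eq_abs t]

end Gamma

/-! ### The cone spline as a push-forward of Gamma weights -/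

/-- The push-forward of the product of the Gamma weights under `t ↦ ∑ tₖ xᵏ`. -/
noncomputable def coneMeasure {n s : ℕ} (X : Fin n → EuclideanSpace ℝ (Fin s)) (α : Fin n → ℝ) :
    Measure (EuclideanSpace ℝ (Fin s)) :=
  (Measure.pi fun k => gammaWeight (α k)).map fun t => ∑ k, t k • X k

section Cone

variable {n s : ℕ} {X : Fin n → EuclideanSpace ℝ (Fin s)} {α : Fin n → ℝ} (hα : ∀ k, 0 < α k)

theorem measurable_sum_smul (X : Fin n → EuclideanSpace ℝ (Fin s)) :
    Measurable fun t : Fin n → ℝ => ∑ k, t k • X k := by fun_prop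

theorem ae_pi_gammaWeight_pos (α : Fin n → ℝ) :
    ∀ᵐ t ∂(Measure.pi fun k => gammaWeight (α k)), ∀ k, 0 < t k :=
  eventually_all.2 fun k =>
    (Measure.quasiMeasurePreserving_eval (μ := fun k => gammaWeight (α k)) k).ae
      (ae_gammaWeight_pos (α k))

include hα

/-- If the cone is pointed, i.e. `‖∑ tₖ xᵏ‖` controls `‖t‖` for nonnegative `t`, then the
push-forward has temperate growth. -/
theorem coneMeasure_hasTemperateGrowth {κ : ℝ} (hκ : 0 < κ)
    (hX : ∀ t : Fin n → ℝ, (∀ k, 0 ≤ t k) → κ * ‖t‖ ≤ ‖∑ k, t k • X k‖) :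
    (coneMeasure X α).HasTemperateGrowth := by
  choose N hN using fun k => (gammaWeight_hasTemperateGrowth (hα k)).exists_integrable
  refine ⟨∑ k, N k, ?_⟩
  rw [coneMeasure, integrable_map_measure
    (Measurable.aestronglyMeasurable (by fun_prop)) (measurable_sum_smul X).aemeasurable]
  have hprod := Integrable.fintype_prod_dep (𝕜 := ℝ) hN
  set κ' : ℝ := min 1 κ with hκ'
  have hκ'0 : 0 < κ' := lt_min one_pos hκ
  refine Integrable.mono' (hprod.const_mul (κ' ^ (-((∑ k, N k : ℕ) : ℝ))))
    (Measurable.aestronglyMeasurable (by fun_prop)) ?_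
  filter_upwards [ae_pi_gammaWeight_pos α] with t ht
  have h1 := hX t fun k => (ht k).le
  have h2 : κ' * (1 + ‖t‖) ≤ 1 + ‖∑ k, t k • X k‖ := by
    have h3 : κ' ≤ 1 := min_le_left _ _
    have h4 : κ' * ‖t‖ ≤ κ * ‖t‖ :=
      mul_le_mul_of_nonneg_right (min_le_right _ _) (norm_nonneg t)
    linarith
  rw [Function.comp_apply, Real.norm_of_nonneg (by positivity)]
  calc (1 + ‖∑ k, t k • X k‖) ^ (-((∑ k, N k : ℕ) : ℝ))
      ≤ (κ' * (1 + ‖t‖)) ^ (-((∑ k, N k : ℕ) : ℝ)) :=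
        Real.rpow_le_rpow_of_nonpos (by positivity) h2 (neg_nonpos.2 (Nat.cast_nonneg _))
    _ = κ' ^ (-((∑ k, N k : ℕ) : ℝ)) * ∏ k, (1 + ‖t‖) ^ (-(N k : ℝ)) := by
        rw [Real.mul_rpow hκ'0.le (by positivity)]
        congr 1
        rw [← Real.rpow_sum_of_pos (by positivity)]
        simp
    _ ≤ κ' ^ (-((∑ k, N k : ℕ) : ℝ)) * ∏ k, (1 + ‖t k‖) ^ (-(N k : ℝ)) := by
        refine mul_le_mul_of_nonneg_left (Finset.prod_le_prod (fun k _ => by positivity)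
          fun k _ => ?_) (by positivity)
        refine Real.rpow_le_rpow_of_nonpos (by positivity) ?_ (neg_nonpos.2 (Nat.cast_nonneg _))
        linarith [norm_le_pi_norm t k]

open Complex in
theorem coneSymbolReg_eq_integral {ε : Fin n → ℝ} (hε : ∀ k, 0 < ε k)
    (ω : EuclideanSpace ℝ (Fin s)) :
    coneSymbolReg X α ε ω = ∫ t : Fin n → ℝ, ∏ k,
      Complex.exp (-(((ε k : ℂ) + I * ((inner ℝ ω (X k) : ℝ) : ℂ)) * (t k : ℂ)))
        ∂(Measure.pi fun k => gammaWeight (α k)) := by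
  rw [integral_fintype_prod_eq_prod (𝕜 := ℂ) (fun k (t : ℝ) =>
    Complex.exp (-(((ε k : ℂ) + I * ((inner ℝ ω (X k) : ℝ) : ℂ)) * (t : ℂ)))), coneSymbolReg]
  refine Finset.prod_congr rfl fun k _ => ?_
  rw [integral_exp_gammaWeight (hα k) (by simpa using hε k)]

open Complex in
/-- Pairing the regularised symbol with a Schwartz function: by Fubini, this is the integral of the
Fourier transform against exponentially damped Gamma weights. -/
theorem integral_mul_coneSymbolReg (g : 𝓢(EuclideanSpace ℝ (Fin s), ℂ)) {ε : Fin n → ℝ}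
    (hε : ∀ k, 0 < ε k) :
    ∫ ξ, g ξ * coneSymbolReg X α ε ((2 * Real.pi) • ξ) =
      ∫ t : Fin n → ℝ, (∏ k, (Real.exp (-(ε k * t k)) : ℂ)) * 𝓕 g (∑ k, t k • X k)
        ∂(Measure.pi fun k => gammaWeight (α k)) := by
  simp_rw [coneSymbolReg_eq_integral hα hε, ← integral_const_mul]
  have hfac : ∀ (ξ : EuclideanSpace ℝ (Fin s)) (t : Fin n → ℝ), ∏ k, Complex.exp
      (-(((ε k : ℂ) + I * ((inner ℝ ((2 * Real.pi) • ξ) (X k) : ℝ) : ℂ)) * (t k : ℂ))) =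
      (∏ k, (Real.exp (-(ε k * t k)) : ℂ)) *
        Complex.exp (((-2 * Real.pi * inner ℝ ξ (∑ k, t k • X k) : ℝ) : ℂ) * I) := by
    intro ξ t
    rw [inner_sum, Finset.mul_sum]
    push_cast
    rw [Finset.sum_mul, Complex.exp_sum, ← Finset.prod_mul_distrib]
    refine Finset.prod_congr rfl fun k _ => ?_
    rw [← Complex.exp_add, real_inner_smul_left, real_inner_smul_right]
    congr 1
    push_cast
    ring
  rw [integral_integral_swap]
  · refine integral_congr_ae (Eventually.of_forall fun t => ?_)
    simp only
    rw [SchwartzMap.fourier_coe, Real.fourier_eq', ← integral_const_mul]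
    refine integral_congr_ae (Eventually.of_forall fun ξ => ?_)
    simp only [hfac, smul_eq_mul]
    ring
  · have hdamp : Integrable (fun t : Fin n → ℝ => ∏ k, (Real.exp (-(ε k * t k)) : ℂ))
        (Measure.pi fun k => gammaWeight (α k)) :=
      Integrable.fintype_prod_dep (𝕜 := ℂ)
        (f := fun k (t : ℝ) => (Real.exp (-(ε k * t)) : ℂ))
        fun k => (integrable_exp_gammaWeight (hα k) (hε k)).ofReal
    have hI := g.integrable (μ := volume).mul_prod hdamp
    refine hI.mono ?_ (Eventually.of_forall fun z => ?_)
    · refine AEStronglyMeasurable.mul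
        (g.continuous.comp continuous_fst).aestronglyMeasurable ?_
      exact Continuous.aestronglyMeasurable (by fun_prop)
    · simp only [Function.uncurry, hfac, norm_mul, Complex.norm_exp_ofReal_mul_I, mul_one, le_refl]

/-- The push-forward of the Gamma weights is the cone spline: dominated convergence as the damping
is removed. -/
theorem isFracConeSpline_coneMeasure [(coneMeasure X α).HasTemperateGrowth] :
    IsFracConeSpline X α (coneMeasure X α).toTemperedDistribution := by
  intro g
  set G : 𝓢(EuclideanSpace ℝ (Fin s), ℂ) := 𝓕 g with hG
  change Tendsto _ _ (𝓝 (∫ x, G x ∂coneMeasure X α))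
  have hint : Integrable G (coneMeasure X α) := G.integrable
  rw [coneMeasure, integrable_map_measure G.continuous.aestronglyMeasurable
    (measurable_sum_smul X).aemeasurable] at hint
  rw [coneMeasure, integral_map (measurable_sum_smul X).aemeasurable
    G.continuous.aestronglyMeasurable]
  have hlim : Tendsto (fun ε : Fin n → ℝ =>
      ∫ t : Fin n → ℝ, (∏ k, (Real.exp (-(ε k * t k)) : ℂ)) * G (∑ k, t k • X k)
        ∂(Measure.pi fun k => gammaWeight (α k))) (𝓝[{ε | ∀ k, 0 < ε k}] 0)
      (𝓝 (∫ t : Fin n → ℝ, G (∑ k, t k • X k)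
        ∂(Measure.pi fun k => gammaWeight (α k)))) := by
    refine tendsto_integral_filter_of_dominated_convergence
      (fun t => ‖G (∑ k, t k • X k)‖) (Eventually.of_forall fun ε => ?_) ?_ hint.norm
      (Eventually.of_forall fun t => ?_)
    · exact (Continuous.aestronglyMeasurable (by fun_prop)).mul hint.1
    · filter_upwards [self_mem_nhdsWithin] with ε (hε : ∀ k, 0 < ε k)
      filter_upwards [ae_pi_gammaWeight_pos α] with t ht
      rw [norm_mul, norm_prod]
      refine mul_le_of_le_one_left (norm_nonneg _)
        (Finset.prod_le_one (fun k _ => norm_nonneg _) fun k _ => ?_)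
      rw [Complex.norm_real, Real.norm_of_nonneg (Real.exp_pos _).le, Real.exp_le_one_iff]
      have := mul_pos (hε k) (ht k)
      linarith
    · have hc : Continuous fun ε : Fin n → ℝ =>
          (∏ k, (Real.exp (-(ε k * t k)) : ℂ)) * G (∑ k, t k • X k) := by fun_prop
      have := (hc.tendsto 0).mono_left (nhdsWithin_le_nhds (s := {ε | ∀ k, 0 < ε k}))
      simpa using this
  refine hlim.congr' ?_
  filter_upwards [self_mem_nhdsWithin] with ε (hε : ∀ k, 0 < ε k)
  exact (integral_mul_coneSymbolReg hα g hε).symm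

end Cone

theorem fracConeSpline_eq {n s : ℕ} {X : Fin n → EuclideanSpace ℝ (Fin s)} {α : Fin n → ℝ}
    {T : 𝓢'(EuclideanSpace ℝ (Fin s), ℂ)} (h : IsFracConeSpline X α T) :
    fracConeSpline X α = T := by
  have h' : ∃ T, IsFracConeSpline X α T := ⟨T, h⟩
  rw [fracConeSpline, dif_pos h']
  exact h'.choose_spec.unique h

/-! ### The two sectors of the spline -/

theorem truncPow_of_neg {r : ℝ} (hr : r < 0) (p : ℝ) : truncPow r p = 0 :=
  if_neg hr.not_ge

theorem truncPow_of_nonneg {r : ℝ} (hr : 0 ≤ r) (p : ℝ) : truncPow r p = r ^ p :=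
  if_pos hr

theorem truncPow_nonneg (r p : ℝ) : 0 ≤ truncPow r p := by
  unfold truncPow
  split_ifs with h
  · exact Real.rpow_nonneg h p
  · exact le_rfl

theorem measurable_truncPow (p : ℝ) : Measurable fun r => truncPow r p :=
  Measurable.ite measurableSet_Ici (by fun_prop) measurable_const

theorem truncPow_eventuallyEq_zero {r : ℝ} (hr : r < 0) (p : ℝ) :
    (fun r => truncPow r p) =ᶠ[𝓝 r] fun _ => 0 := by
  filter_upwards [Iio_mem_nhds hr] with x hx using truncPow_of_neg hx p

theorem continuousAt_truncPow {r p : ℝ} (h : r ≠ 0 ∨ 0 < p) :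
    ContinuousAt (fun r => truncPow r p) r := by
  rcases lt_trichotomy r 0 with hr | rfl | hr
  · exact continuousAt_const.congr (truncPow_eventuallyEq_zero hr p).symm
  · have hp : 0 < p := h.resolve_left (by simp)
    have h1 : (fun r => truncPow r p) = fun r => (max r 0) ^ p := by
      ext r
      rcases lt_or_ge r 0 with hr | hr
      · rw [truncPow_of_neg hr, max_eq_right hr.le, Real.zero_rpow hp.ne']
      · rw [truncPow_of_nonneg hr, max_eq_left hr]
    rw [h1]
    exact (Continuous.rpow_const (by fun_prop) fun _ => Or.inr hp.le).continuousAt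
  · refine (Real.continuousAt_rpow_const r p (Or.inl hr.ne')).congr ?_
    filter_upwards [Ioi_mem_nhds hr] with x (hx : 0 < x)
    exact (truncPow_of_nonneg hx.le p).symm

theorem continuousOn_gaussHypergeometric (A : ℝ) {b c : ℝ} (hb : 0 < b) (hc : 0 < c) :
    ContinuousOn (gaussHypergeometric A b (b + c)) (Set.Iio 1) :=
  ((analyticOnNhd_eulerIntegral A hb hc).continuousOn.const_mul _).congr fun _ hz =>
    gaussHypergeometric_eq_eulerIntegral A hb hc hz

theorem measurable_gaussHypergeometric (A : ℝ) {b c : ℝ} (hb : 0 < b) (hc : 0 < c) :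
    Measurable (gaussHypergeometric A b (b + c)) := by
  classical
  have h := ContinuousOn.measurable_piecewise (g := fun _ => (0 : ℝ))
    (continuousOn_gaussHypergeometric A hb hc) continuousOn_const measurableSet_Iio
  convert! h using 1
  ext z
  by_cases hz : z ∈ Set.Iio (1 : ℝ)
  · rw [Set.piecewise_eq_of_mem _ _ _ hz]
  · rw [Set.piecewise_eq_of_notMem _ _ _ hz, gaussHypergeometric]
    split_ifs with h1 h2
    · exact absurd h2 hz
    all_goals rfl

/-- The spline, up to the Jacobian factor, on one side of the central line, as a function of the
height `y > 0` over that line and of the coordinate `u` transversal to the outer edge. -/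
noncomputable def sectorValue (a b c y u : ℝ) : ℝ :=
  1 / (Real.Gamma a * Real.Gamma (b + c)) * y ^ (a - 1) * truncPow u (b + c - 1) *
    gaussHypergeometric (1 - a) b (b + c) (-(u / y))

/-- The integral `∫₀¹ τ ^ (b - 1) (1 - τ) ^ (c - 1) (y + u τ) ^ (a - 1) dτ`. -/
noncomputable def sectorIntegral (a b c y u : ℝ) : ℝ :=
  ∫ τ in Set.Ioo (0 : ℝ) 1, betaWeight b c τ * (y + u * τ) ^ (a - 1)

/-- The common limit of the two sectors on the central line. -/
noncomputable def centralValue (a b c r : ℝ) : ℝ :=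
  (Real.Gamma a * Real.Gamma b * Real.Gamma c)⁻¹ *
    ((∫ τ in Set.Ioo (0 : ℝ) 1, betaWeight (a + b - 1) c τ) * truncPow r (a + b + c - 2))

theorem centralValue_comm (a b c r : ℝ) : centralValue a b c r = centralValue b a c r := by
  rw [centralValue, centralValue, mul_comm (Real.Gamma a), add_comm a b]

theorem centralValue_nonneg {a b c : ℝ} (ha : 0 < a) (hb : 0 < b) (hc : 0 < c) (r : ℝ) :
    0 ≤ centralValue a b c r := by
  have h1 := Real.Gamma_pos_of_pos ha
  have h2 := Real.Gamma_pos_of_pos hb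
  have h3 := Real.Gamma_pos_of_pos hc
  refine mul_nonneg (by positivity) (mul_nonneg ?_ (truncPow_nonneg _ _))
  exact setIntegral_nonneg measurableSet_Ioo fun τ hτ => betaWeight_nonneg _ _ hτ

theorem sectorValue_of_neg (a b c y : ℝ) {u : ℝ} (hu : u < 0) : sectorValue a b c y u = 0 := by
  rw [sectorValue, truncPow_of_neg hu]; ring

section Sector

variable {a b c : ℝ} (ha : 0 < a) (hb : 0 < b) (hc : 0 < c)

include hb hc

theorem measurable_sectorValue (a : ℝ) :
    Measurable fun z : ℝ × ℝ => sectorValue a b c z.1 z.2 := by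
  have h1 := (measurable_truncPow (b + c - 1)).comp
    (show Measurable (Prod.snd : ℝ × ℝ → ℝ) from measurable_snd)
  have h2 := (measurable_gaussHypergeometric (1 - a) hb hc).comp
    (show Measurable fun z : ℝ × ℝ => -(z.2 / z.1) by fun_prop)
  unfold sectorValue
  exact ((Measurable.const_mul (by fun_prop) _).mul h1).mul h2

theorem sectorValue_eq (a : ℝ) {y : ℝ} (hy : 0 < y) (u : ℝ) :
    sectorValue a b c y u = (Real.Gamma a * Real.Gamma b * Real.Gamma c)⁻¹ *
      (truncPow u (b + c - 1) * sectorIntegral a b c y u) := by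
  rcases lt_or_ge u 0 with hu | hu
  · rw [sectorValue_of_neg _ _ _ _ hu, truncPow_of_neg hu]; ring
  have hz : -(u / y) < 1 := by
    have : 0 ≤ u / y := by positivity
    linarith
  have hI : sectorIntegral a b c y u = y ^ (a - 1) * eulerIntegral (1 - a) b c (-(u / y)) := by
    rw [sectorIntegral, eulerIntegral, ← integral_const_mul]
    refine setIntegral_congr_fun measurableSet_Ioo fun τ hτ => ?_
    rw [show y + u * τ = y * (1 - -(u / y) * τ) by field_simp; ring, Real.mul_rpow hy.le]
    · ring_nf
    · have : 0 ≤ u / y * τ := mul_nonneg (by positivity) hτ.1.le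
      linarith
  rw [sectorValue, gaussHypergeometric_eq_eulerIntegral _ hb hc hz, hI]
  have := (Real.Gamma_pos_of_pos (add_pos hb hc)).ne'
  have := (Real.Gamma_pos_of_pos hb).ne'
  have := (Real.Gamma_pos_of_pos hc).ne'
  rcases eq_or_ne (Real.Gamma a) 0 with h | h
  · simp [h]
  · field_simp

theorem continuousAt_sectorValue (a : ℝ) {y u : ℝ} (hy : 0 < y) (h : u ≠ 0 ∨ 1 < b + c) :
    ContinuousAt (fun z : ℝ × ℝ => sectorValue a b c z.1 z.2) (y, u) := by
  rcases lt_or_ge u 0 with hu | hu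
  · refine (continuousAt_const (y := (0 : ℝ))).congr ?_
    filter_upwards [continuousAt_snd.eventually (Iio_mem_nhds hu)] with z hz
    exact (sectorValue_of_neg _ _ _ _ hz).symm
  · have hz : -(u / y) < 1 := by
      have : 0 ≤ u / y := by positivity
      linarith
    have h1 : ContinuousAt (fun z : ℝ × ℝ => truncPow z.2 (b + c - 1)) (y, u) :=
      ContinuousAt.comp (f := Prod.snd) (x := (y, u))
        (continuousAt_truncPow (h.imp id fun h => by linarith)) continuousAt_snd
    have h2 : ContinuousAt (fun z : ℝ × ℝ => -(z.2 / z.1)) (y, u) :=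
      (continuousAt_snd.div continuousAt_fst hy.ne').neg
    have h3 : ContinuousAt
        (fun z : ℝ × ℝ => gaussHypergeometric (1 - a) b (b + c) (-(z.2 / z.1))) (y, u) :=
      ContinuousAt.comp (f := fun z : ℝ × ℝ => -(z.2 / z.1)) (x := (y, u))
        ((continuousOn_gaussHypergeometric (1 - a) hb hc).continuousAt (Iio_mem_nhds hz)) h2
    have h4 : ContinuousAt (fun z : ℝ × ℝ => z.1 ^ (a - 1)) (y, u) :=
      continuousAt_fst.rpow_const (Or.inl hy.ne')
    exact ((continuousAt_const.mul h4).mul h1).mul h3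

omit hb in
theorem integrableOn_betaWeight_mul_rpow (h : 1 < a + b) :
    IntegrableOn (fun τ => betaWeight b c τ * τ ^ (a - 1)) (Set.Ioo 0 1) := by
  refine (integrableOn_betaWeight (b := a + b - 1) (by linarith) hc).congr_fun
    (fun τ hτ => ?_) measurableSet_Ioo
  simp only [betaWeight]
  rw [show a + b - 1 - 1 = (b - 1) + (a - 1) by ring, Real.rpow_add hτ.1]
  ring

/-- The dominating function: `(y + u τ) ^ (a - 1) ≤ (m τ) ^ (a - 1) + R ^ (a - 1)` whenever
`m τ ≤ y + u τ ≤ R` with `m > 0`. -/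
theorem integrableOn_sector_bound (h : 1 < a + b) {m : ℝ} (hm : 0 < m) (R : ℝ) :
    IntegrableOn (fun τ => betaWeight b c τ * ((m * τ) ^ (a - 1) + R ^ (a - 1)))
      (Set.Ioo 0 1) := by
  have h1 := ((integrableOn_betaWeight_mul_rpow hc h).const_mul (m ^ (a - 1))).add
    ((integrableOn_betaWeight hb hc).mul_const (R ^ (a - 1)))
  refine IntegrableOn.congr_fun h1 (fun τ hτ => ?_) measurableSet_Ioo
  simp only [Pi.add_apply]
  rw [Real.mul_rpow hm.le hτ.1.le]
  ring

theorem tendsto_sectorIntegral (h : 1 < a + b) {r : ℝ} (hr : 0 < r) :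
    Tendsto (fun z : ℝ × ℝ => sectorIntegral a b c z.1 z.2) (𝓝[{z | 0 < z.1}] (0, r))
      (𝓝 (sectorIntegral a b c 0 r)) := by
  refine tendsto_integral_filter_of_dominated_convergence
    (fun τ => betaWeight b c τ * ((r / 2 * τ) ^ (a - 1) + (1 + 2 * r) ^ (a - 1)))
    (Eventually.of_forall fun z => ?_) ?_
    (integrableOn_sector_bound hb hc h (by positivity) _) ?_
  · have := measurable_betaWeight b c
    exact Measurable.aestronglyMeasurable (by fun_prop)
  · have hy : ∀ᶠ z : ℝ × ℝ in 𝓝 (0, r), z.1 < 1 :=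
      continuousAt_fst.eventually (Iio_mem_nhds one_pos)
    have hu1 : ∀ᶠ z : ℝ × ℝ in 𝓝 (0, r), r / 2 < z.2 :=
      continuousAt_snd.eventually (Ioi_mem_nhds (by dsimp only; linarith))
    have hu2 : ∀ᶠ z : ℝ × ℝ in 𝓝 (0, r), z.2 < 2 * r :=
      continuousAt_snd.eventually (Iio_mem_nhds (by dsimp only; linarith))
    filter_upwards [self_mem_nhdsWithin, nhdsWithin_le_nhds hy, nhdsWithin_le_nhds hu1,
      nhdsWithin_le_nhds hu2] with z (h0 : 0 < z.1) h1 h2 h3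
    filter_upwards [ae_restrict_mem measurableSet_Ioo] with τ hτ
    have h4 : r / 2 * τ ≤ z.2 * τ := mul_le_mul_of_nonneg_right h2.le hτ.1.le
    have h5 : z.2 * τ ≤ z.2 := mul_le_of_le_one_right (by linarith) hτ.2.le
    have h6 : 0 < r / 2 * τ := mul_pos (by positivity) hτ.1
    rw [norm_mul, Real.norm_of_nonneg (betaWeight_nonneg b c hτ),
      Real.norm_of_nonneg (Real.rpow_nonneg (by linarith) _)]
    exact mul_le_mul_of_nonneg_left (rpow_le_rpow_add_rpow h6 (by linarith) (by linarith))
      (betaWeight_nonneg b c hτ)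
  · filter_upwards [ae_restrict_mem measurableSet_Ioo] with τ hτ
    have h1 : ContinuousAt (fun z : ℝ × ℝ => z.1 + z.2 * τ) (0, r) := by fun_prop
    have h2 : ContinuousAt (fun z : ℝ × ℝ => betaWeight b c τ * (z.1 + z.2 * τ) ^ (a - 1))
        (0, r) := by
      refine continuousAt_const.mul (h1.rpow_const (Or.inl ?_))
      have := mul_pos hr hτ.1
      simpa using this.ne'
    exact h2.tendsto.mono_left nhdsWithin_le_nhds

/-- Each sector has the limit `centralValue` on the central ray. -/
theorem tendsto_sectorValue (h : 1 < a + b) {r : ℝ} (hr : 0 < r) :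
    Tendsto (fun z : ℝ × ℝ => sectorValue a b c z.1 z.2) (𝓝[{z | 0 < z.1}] (0, r))
      (𝓝 (centralValue a b c r)) := by
  have h1 : Tendsto (fun z : ℝ × ℝ => truncPow z.2 (b + c - 1)) (𝓝[{z | 0 < z.1}] (0, r))
      (𝓝 (truncPow r (b + c - 1))) :=
    ((continuousAt_truncPow (Or.inl hr.ne')).tendsto.comp
      (continuousAt_snd (p := ((0 : ℝ), r))).tendsto).mono_left nhdsWithin_le_nhds
  have h2 := (h1.mul (tendsto_sectorIntegral hb hc h hr)).const_mul
    (Real.Gamma a * Real.Gamma b * Real.Gamma c)⁻¹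
  have h3 : truncPow r (b + c - 1) * sectorIntegral a b c 0 r =
      (∫ τ in Set.Ioo (0 : ℝ) 1, betaWeight (a + b - 1) c τ) * truncPow r (a + b + c - 2) := by
    have h4 : sectorIntegral a b c 0 r =
        (∫ τ in Set.Ioo (0 : ℝ) 1, betaWeight (a + b - 1) c τ) * r ^ (a - 1) := by
      rw [sectorIntegral, ← integral_mul_const]
      refine setIntegral_congr_fun measurableSet_Ioo fun τ hτ => ?_
      simp only [betaWeight]
      rw [zero_add, Real.mul_rpow hr.le hτ.1.le,
        show a + b - 1 - 1 = (b - 1) + (a - 1) by ring, Real.rpow_add hτ.1]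
      ring
    rw [h4, truncPow_of_nonneg hr.le, truncPow_of_nonneg hr.le,
      show a + b + c - 2 = (b + c - 1) + (a - 1) by ring, Real.rpow_add hr]
    ring
  rw [h3] at h2
  refine h2.congr' ?_
  filter_upwards [self_mem_nhdsWithin] with z (hz : 0 < z.1)
  exact (sectorValue_eq hb hc a hz z.2).symm

include ha

theorem sectorValue_nonneg {y : ℝ} (hy : 0 < y) (u : ℝ) : 0 ≤ sectorValue a b c y u := by
  rcases lt_or_ge u 0 with hu | hu
  · rw [sectorValue_of_neg _ _ _ _ hu]
  rw [sectorValue_eq hb hc a hy]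
  have h1 := Real.Gamma_pos_of_pos ha
  have h2 := Real.Gamma_pos_of_pos hb
  have h3 := Real.Gamma_pos_of_pos hc
  refine mul_nonneg (by positivity) (mul_nonneg (truncPow_nonneg _ _) ?_)
  refine setIntegral_nonneg measurableSet_Ioo fun τ hτ => ?_
  refine mul_nonneg (betaWeight_nonneg _ _ hτ) (Real.rpow_nonneg ?_ _)
  have := mul_nonneg hu hτ.1.le
  linarith

/-- Near the apex the sector is bounded by the power of homogeneity `a + b + c - 2` of `y + u`. -/
theorem exists_sectorValue_le (h : 1 < a + b) (h' : 1 ≤ b + c) :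
    ∃ K : ℝ, ∀ y u : ℝ, 0 < y →
      |sectorValue a b c y u| ≤ K * |y + u| ^ (a + b + c - 2) := by
  have hΓ := mul_pos (mul_pos (Real.Gamma_pos_of_pos ha) (Real.Gamma_pos_of_pos hb))
    (Real.Gamma_pos_of_pos hc)
  set K₁ := ∫ τ in Set.Ioo (0 : ℝ) 1, betaWeight b c τ * (τ ^ (a - 1) + 1) with hK₁
  have hint : IntegrableOn (fun τ => betaWeight b c τ * (τ ^ (a - 1) + 1)) (Set.Ioo 0 1) := by
    simpa using integrableOn_sector_bound hb hc h one_pos 1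
  have hK₁0 : 0 ≤ K₁ := by
    refine setIntegral_nonneg measurableSet_Ioo fun τ hτ => ?_
    have := Real.rpow_nonneg hτ.1.le (a - 1)
    exact mul_nonneg (betaWeight_nonneg b c hτ) (by linarith)
  refine ⟨(Real.Gamma a * Real.Gamma b * Real.Gamma c)⁻¹ * K₁, fun y u hy => ?_⟩
  rw [abs_of_nonneg (sectorValue_nonneg ha hb hc hy u)]
  rcases lt_or_ge u 0 with hu | hu
  · rw [sectorValue_of_neg _ _ _ _ hu]
    positivity
  have hs : 0 < y + u := by linarith
  rw [sectorValue_eq hb hc a hy, truncPow_of_nonneg hu, abs_of_pos hs,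
    mul_assoc (Real.Gamma a * Real.Gamma b * Real.Gamma c)⁻¹]
  refine mul_le_mul_of_nonneg_left ?_ (inv_nonneg.2 hΓ.le)
  have hI : sectorIntegral a b c y u ≤ K₁ * (y + u) ^ (a - 1) := by
    rw [sectorIntegral, hK₁, ← integral_mul_const]
    refine integral_mono_of_nonneg ?_ (hint.mul_const _) ?_
    · filter_upwards [ae_restrict_mem measurableSet_Ioo] with τ hτ
      have := mul_nonneg hu hτ.1.le
      exact mul_nonneg (betaWeight_nonneg b c hτ) (Real.rpow_nonneg (by linarith) _)
    · filter_upwards [ae_restrict_mem measurableSet_Ioo] with τ hτ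
      have h1 : u * τ ≤ u := mul_le_of_le_one_right hu hτ.2.le
      have h2 : y * τ ≤ y := mul_le_of_le_one_right hy.le hτ.2.le
      have h3 := rpow_le_rpow_add_rpow (p := a - 1) (mul_pos hs hτ.1)
        (v := y + u * τ) (R := y + u) (by linarith) (by linarith)
      rw [mul_assoc]
      refine mul_le_mul_of_nonneg_left (h3.trans_eq ?_) (betaWeight_nonneg b c hτ)
      rw [Real.mul_rpow hs.le hτ.1.le]
      ring
  calc u ^ (b + c - 1) * sectorIntegral a b c y u
      ≤ (y + u) ^ (b + c - 1) * (K₁ * (y + u) ^ (a - 1)) :=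
        mul_le_mul (Real.rpow_le_rpow hu (by linarith) (by linarith)) hI
          (setIntegral_nonneg measurableSet_Ioo fun τ hτ =>
            mul_nonneg (betaWeight_nonneg b c hτ)
              (Real.rpow_nonneg (by have := mul_nonneg hu hτ.1.le; linarith) _))
          (Real.rpow_nonneg hs.le _)
    _ = K₁ * (y + u) ^ (a + b + c - 2) := by
        rw [show a + b + c - 2 = (b + c - 1) + (a - 1) by ring, Real.rpow_add hs]
        ring

theorem tendsto_sectorValue_apex (h : 1 < a + b) (h' : 1 ≤ b + c) (h2 : 2 < a + b + c) :
    Tendsto (fun z : ℝ × ℝ => sectorValue a b c z.1 z.2) (𝓝[{z | 0 < z.1}] (0, 0)) (𝓝 0) := by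
  obtain ⟨K, hK⟩ := exists_sectorValue_le ha hb hc h h'
  have hcont : Continuous fun z : ℝ × ℝ => K * |z.1 + z.2| ^ (a + b + c - 2) :=
    continuous_const.mul (Continuous.rpow_const (by fun_prop) fun _ => Or.inr (by linarith))
  have hlim := (hcont.tendsto (0, 0)).mono_left (nhdsWithin_le_nhds (s := {z | 0 < z.1}))
  have h0 : (0 : ℝ) ^ (a + b + c - 2) = 0 := Real.zero_rpow (by linarith)
  simp only [add_zero, abs_zero, h0, mul_zero] at hlim
  refine squeeze_zero_norm' ?_ hlim
  filter_upwards [self_mem_nhdsWithin] with z (hz : 0 < z.1) using hK z.1 z.2 hz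

/-- The limit of a sector at any point of the central line where continuity is claimed. -/
theorem tendsto_sectorValue_centralValue {r : ℝ} (h1 : 0 < r → 1 < a + b)
    (h2 : r = 0 → 1 < a + b ∧ 1 ≤ b + c ∧ 2 < a + b + c) :
    Tendsto (fun z : ℝ × ℝ => sectorValue a b c z.1 z.2) (𝓝[{z | 0 < z.1}] (0, r))
      (𝓝 (if 1 < a + b then centralValue a b c r else 0)) := by
  rcases lt_trichotomy r 0 with hr | rfl | hr
  · have : (if 1 < a + b then centralValue a b c r else 0) = 0 := by
      simp [centralValue, truncPow_of_neg hr]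
    rw [this]
    refine tendsto_const_nhds.congr' ?_
    have : ∀ᶠ z : ℝ × ℝ in 𝓝 (0, r), z.2 < 0 := continuousAt_snd.eventually (Iio_mem_nhds hr)
    filter_upwards [nhdsWithin_le_nhds this] with z hz
    exact (sectorValue_of_neg _ _ _ _ hz).symm
  · obtain ⟨h3, h4, h5⟩ := h2 rfl
    have : centralValue a b c 0 = 0 := by
      simp [centralValue, truncPow_of_nonneg le_rfl, Real.zero_rpow (sub_pos.2 h5).ne']
    rw [if_pos h3, this]
    exact tendsto_sectorValue_apex ha hb hc h3 h4 h5
  · rw [if_pos (h1 hr)]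
    exact tendsto_sectorValue hb hc (h1 hr) hr

end Sector

/-! ### The density of the push-forward -/

section Iterated

theorem lintegral_pi_fin_two (μ : Fin 2 → Measure ℝ) [∀ i, SigmaFinite (μ i)]
    {f : (Fin 2 → ℝ) → ENNReal} (hf : Measurable f) :
    ∫⁻ x, f x ∂Measure.pi μ = ∫⁻ s, ∫⁻ u, f ![s, u] ∂μ 1 ∂μ 0 := by
  have h := (measurePreserving_piFinTwo μ).symm
  rw [← h.lintegral_comp hf]
  refine (lintegral_prod _ (hf.comp h.measurable).aemeasurable).trans ?_
  rfl

theorem lintegral_pi_fin_three (μ : Fin 3 → Measure ℝ) [∀ i, SigmaFinite (μ i)]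
    {f : (Fin 3 → ℝ) → ENNReal} (hf : Measurable f) :
    ∫⁻ x, f x ∂Measure.pi μ = ∫⁻ t, ∫⁻ s, ∫⁻ u, f ![s, u, t] ∂μ 1 ∂μ 0 ∂μ 2 := by
  have h := (measurePreserving_piFinSuccAbove μ 2).symm
  rw [← h.lintegral_comp hf]
  refine (lintegral_prod _ (hf.comp h.measurable).aemeasurable).trans ?_
  refine lintegral_congr fun t => ?_
  have h2 : Measurable fun y : Fin 2 → ℝ =>
      f ((MeasurableEquiv.piFinSuccAbove (fun _ : Fin 3 => ℝ) 2).symm (t, y)) :=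
    hf.comp (h.measurable.comp (by fun_prop))
  have h3 := lintegral_pi_fin_two (fun j => μ ((2 : Fin 3).succAbove j)) h2
  refine h3.trans (lintegral_congr fun s => lintegral_congr fun u => ?_)
  congr 1
  ext i
  fin_cases i <;> rfl

/-- The extended-real density of `gammaWeight a`. -/
noncomputable def gammaDensity (a t : ℝ) : ENNReal :=
  (Set.Ioi (0 : ℝ)).indicator (fun t => ENNReal.ofReal (t ^ (a - 1) / Real.Gamma a)) t

@[fun_prop]
theorem measurable_gammaDensity (a : ℝ) : Measurable (gammaDensity a) :=
  (measurable_gammaWeight_density a).indicator measurableSet_Ioi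

theorem gammaDensity_of_pos (a : ℝ) {t : ℝ} (ht : 0 < t) :
    gammaDensity a t = ENNReal.ofReal (t ^ (a - 1) / Real.Gamma a) :=
  Set.indicator_of_mem (Set.mem_Ioi.2 ht) _

theorem gammaDensity_of_nonpos (a : ℝ) {t : ℝ} (ht : t ≤ 0) : gammaDensity a t = 0 :=
  Set.indicator_of_notMem (by simpa using ht) _

theorem lintegral_gammaWeight (a : ℝ) {f : ℝ → ENNReal} (hf : Measurable f) :
    ∫⁻ t, f t ∂gammaWeight a = ∫⁻ t, gammaDensity a t * f t := by
  rw [gammaWeight, ← withDensity_indicator measurableSet_Ioi]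
  exact lintegral_withDensity_eq_lintegral_mul _ (measurable_gammaDensity a) hf

/-- With the first two parameters shifted by the third, the integral over the octant is an integral
over the plane against a density given by a one-dimensional integral. -/
theorem lintegral_gammaWeight_shear (α : Fin 3 → ℝ) {f : ℝ × ℝ → ENNReal} (hf : Measurable f) :
    ∫⁻ t, f (t 0 + t 2, t 1 + t 2) ∂(Measure.pi fun k => gammaWeight (α k)) =
      ∫⁻ s, ∫⁻ u, f (s, u) *
        ∫⁻ t, gammaDensity (α 2) t * (gammaDensity (α 0) (s - t) * gammaDensity (α 1) (u - t)) := by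
  rw [lintegral_pi_fin_three (fun k => gammaWeight (α k))
    (f := fun t => f (t 0 + t 2, t 1 + t 2)) (by fun_prop)]
  have step : ∀ t : ℝ, (∫⁻ s, ∫⁻ u, f (s + t, u + t) ∂gammaWeight (α 1) ∂gammaWeight (α 0)) =
      ∫⁻ s, ∫⁻ u, gammaDensity (α 0) (s - t) * (gammaDensity (α 1) (u - t) * f (s, u)) := by
    intro t
    have h1 : ∀ s, ∫⁻ u, f (s + t, u + t) ∂gammaWeight (α 1) =
        ∫⁻ u, gammaDensity (α 1) (u - t) * f (s + t, u) := by
      intro s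
      rw [lintegral_gammaWeight _ (by fun_prop),
        ← lintegral_sub_right_eq_self (fun u => gammaDensity (α 1) u * f (s + t, u + t)) t]
      simp only [sub_add_cancel]
    simp_rw [h1]
    have hm : Measurable fun p : ℝ × ℝ => gammaDensity (α 1) (p.2 - t) * f (p.1 + t, p.2) := by
      fun_prop
    rw [lintegral_gammaWeight _ hm.lintegral_prod_right',
      ← lintegral_sub_right_eq_self _ t]
    refine lintegral_congr fun s => ?_
    rw [← lintegral_const_mul _ (by fun_prop)]
    simp only [sub_add_cancel]
  have hG : Measurable fun p : ℝ × ℝ × ℝ => gammaDensity (α 2) p.1 *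
      (gammaDensity (α 0) (p.2.1 - p.1) * (gammaDensity (α 1) (p.2.2 - p.1) * f p.2)) := by
    fun_prop
  have hstep : Measurable fun t : ℝ => ∫⁻ s, ∫⁻ u,
      gammaDensity (α 0) (s - t) * (gammaDensity (α 1) (u - t) * f (s, u)) := by
    have h1 : Measurable fun p : (ℝ × ℝ) × ℝ => gammaDensity (α 0) (p.1.2 - p.1.1) *
      (gammaDensity (α 1) (p.2 - p.1.1) * f (p.1.2, p.2)) := by fun_prop
    exact h1.lintegral_prod_right'.lintegral_prod_right'
  change ∫⁻ t, ∫⁻ s, ∫⁻ u, f (s + t, u + t) ∂gammaWeight (α 1) ∂gammaWeight (α 0)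
    ∂gammaWeight (α 2) = _
  simp_rw [step]
  rw [lintegral_gammaWeight _ hstep]
  have e1 : ∀ t, gammaDensity (α 2) t * (∫⁻ s, ∫⁻ u,
      gammaDensity (α 0) (s - t) * (gammaDensity (α 1) (u - t) * f (s, u))) =
      ∫⁻ s, ∫⁻ u, gammaDensity (α 2) t *
        (gammaDensity (α 0) (s - t) * (gammaDensity (α 1) (u - t) * f (s, u))) := by
    intro t
    have h1 : Measurable fun p : ℝ × ℝ => gammaDensity (α 0) (p.1 - t) *
      (gammaDensity (α 1) (p.2 - t) * f p) := by fun_prop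
    rw [← lintegral_const_mul _ h1.lintegral_prod_right']
    refine lintegral_congr fun s => ?_
    rw [← lintegral_const_mul _ (by fun_prop)]
  simp_rw [e1]
  rw [lintegral_lintegral_swap]
  · refine lintegral_congr fun s => ?_
    rw [lintegral_lintegral_swap]
    · refine lintegral_congr fun u => ?_
      rw [← lintegral_const_mul _ (by fun_prop)]
      refine lintegral_congr fun t => ?_
      ring
    · exact (hG.comp (show Measurable fun p : ℝ × ℝ => (p.1, s, p.2) by fun_prop)).aemeasurable
  · have h1 : Measurable fun p : (ℝ × ℝ) × ℝ => gammaDensity (α 2) p.1.1 *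
      (gammaDensity (α 0) (p.1.2 - p.1.1) *
        (gammaDensity (α 1) (p.2 - p.1.1) * f (p.1.2, p.2))) := by fun_prop
    exact h1.lintegral_prod_right'.aemeasurable

end Iterated

section Density

variable {a b c : ℝ} (ha : 0 < a) (hb : 0 < b) (hc : 0 < c)

include ha hb hc

/-- The density in one sector, by the substitution `t = u (1 - τ)`. The edge `u = 0` is excluded:
there the integral vanishes, while `sectorValue` does not if `b + c = 1`, as `0 ^ 0 = 1`. -/
theorem lintegral_gammaDensity {s u : ℝ} (hsu : u < s) (hu : u ≠ 0) :
    ∫⁻ t, gammaDensity c t * (gammaDensity a (s - t) * gammaDensity b (u - t)) =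
      ENNReal.ofReal (sectorValue a b c (s - u) u) := by
  rcases hu.lt_or_gt with hu | hu
  · rw [sectorValue_of_neg _ _ _ _ hu, ENNReal.ofReal_zero]
    refine lintegral_eq_zero_of_ae_eq_zero (Eventually.of_forall fun t => ?_)
    rcases le_or_gt t 0 with ht | ht
    · simp [gammaDensity_of_nonpos c ht]
    · simp [gammaDensity_of_nonpos b (show u - t ≤ 0 by linarith)]
  have hy : 0 < s - u := sub_pos.2 hsu
  have hΓa := Real.Gamma_pos_of_pos ha
  have hΓb := Real.Gamma_pos_of_pos hb
  have hΓc := Real.Gamma_pos_of_pos hc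
  have himage : (fun τ : ℝ => u * (1 - τ)) '' Set.Ioo 0 1 = Set.Ioo 0 u := by
    ext t
    constructor
    · rintro ⟨τ, hτ, rfl⟩
      have := mul_pos hu hτ.1
      have := mul_pos hu (sub_pos.2 hτ.2)
      constructor <;> linarith
    · intro ht
      refine ⟨1 - t / u, ⟨?_, ?_⟩, ?_⟩
      · rw [sub_pos, div_lt_one hu]; exact ht.2
      · have := div_pos ht.1 hu; linarith
      · field_simp; ring
  have hsupp : ∫⁻ t, gammaDensity c t * (gammaDensity a (s - t) * gammaDensity b (u - t)) =
      ∫⁻ t in Set.Ioo 0 u,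
        gammaDensity c t * (gammaDensity a (s - t) * gammaDensity b (u - t)) := by
    rw [← lintegral_indicator measurableSet_Ioo]
    refine lintegral_congr fun t => ?_
    by_cases ht : t ∈ Set.Ioo 0 u
    · rw [Set.indicator_of_mem ht]
    · rw [Set.indicator_of_notMem ht]
      rcases le_or_gt t 0 with h0 | h0
      · simp [gammaDensity_of_nonpos c h0]
      · have : u ≤ t := not_lt.1 fun h => ht ⟨h0, h⟩
        simp [gammaDensity_of_nonpos b (show u - t ≤ 0 by linarith)]
  have hinj : Set.InjOn (fun τ : ℝ => u * (1 - τ)) (Set.Ioo 0 1) := by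
    intro x _ y _ hxy
    have := mul_left_cancel₀ hu.ne' hxy
    linarith
  have hder : ∀ x ∈ Set.Ioo (0 : ℝ) 1,
      HasDerivWithinAt (fun τ : ℝ => u * (1 - τ)) (-u) (Set.Ioo 0 1) x := by
    intro x _
    have := (((hasDerivAt_id x).const_sub 1).const_mul u).hasDerivWithinAt (s := Set.Ioo 0 1)
    simpa using this
  have hbound : ∀ τ ∈ Set.Ioo (0 : ℝ) 1, s - u ≤ s - u + u * τ ∧ s - u + u * τ ≤ s := by
    intro τ hτ
    have h1 := mul_pos hu hτ.1
    have h2 := mul_pos hu (sub_pos.2 hτ.2)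
    constructor <;> linarith
  have hint : IntegrableOn (fun τ => betaWeight b c τ * (s - u + u * τ) ^ (a - 1))
      (Set.Ioo 0 1) := by
    refine Integrable.mono' ((integrableOn_betaWeight hb hc).mul_const
      ((s - u) ^ (a - 1) + s ^ (a - 1))) ?_ ?_
    · have := measurable_betaWeight b c
      exact Measurable.aestronglyMeasurable (by fun_prop)
    · filter_upwards [ae_restrict_mem measurableSet_Ioo] with τ hτ
      obtain ⟨h1, h2⟩ := hbound τ hτ
      rw [norm_mul, Real.norm_of_nonneg (betaWeight_nonneg b c hτ),
        Real.norm_of_nonneg (Real.rpow_nonneg (hy.le.trans h1) _)]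
      exact mul_le_mul_of_nonneg_left (rpow_le_rpow_add_rpow hy h1 h2)
        (betaWeight_nonneg b c hτ)
  rw [hsupp, ← himage, lintegral_image_eq_lintegral_abs_deriv_mul measurableSet_Ioo hder hinj,
    sectorValue_eq hb hc a hy, truncPow_of_nonneg hu.le, sectorIntegral, ← mul_assoc,
    ← integral_const_mul, ofReal_integral_eq_lintegral_ofReal (hint.const_mul _)]
  · refine setLIntegral_congr_fun measurableSet_Ioo fun τ hτ => ?_
    have hτ1 : 0 < 1 - τ := sub_pos.2 hτ.2
    have h1 : 0 < u * (1 - τ) := mul_pos hu hτ1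
    have h2 : 0 < u * τ := mul_pos hu hτ.1
    have h3 : u - u * (1 - τ) = u * τ := by ring
    have h4 : s - u * (1 - τ) = s - u + u * τ := by ring
    have h5 : 0 < s - u + u * τ := by linarith
    have h6 := Real.rpow_nonneg h1.le (c - 1)
    have h7 := Real.rpow_nonneg h5.le (a - 1)
    rw [h3, h4, gammaDensity_of_pos c h1, gammaDensity_of_pos a h5, gammaDensity_of_pos b h2,
      ← ENNReal.ofReal_mul (by positivity), ← ENNReal.ofReal_mul (by positivity),
      ← ENNReal.ofReal_mul (by positivity), abs_neg, abs_of_pos hu, betaWeight,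
      Real.mul_rpow hu.le hτ1.le, Real.mul_rpow hu.le hτ.1.le,
      show b + c - 1 = 1 + (b - 1) + (c - 1) by ring, Real.rpow_add hu, Real.rpow_add hu,
      Real.rpow_one]
    congr 1
    field_simp
  · filter_upwards [ae_restrict_mem measurableSet_Ioo] with τ hτ
    have h1 := betaWeight_nonneg b c hτ
    have h2 := Real.rpow_nonneg (hy.le.trans (hbound τ hτ).1) (a - 1)
    have h3 := Real.rpow_nonneg hu.le (b + c - 1)
    simp only [Pi.zero_apply]
    positivity

end Density

/-! ### The three-directional mesh -/

/-- The three-directional cone spline with `x¹ = (p, q)`, `x² = (1 - p, -q)`, `x³ = (1, 0)`. On the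
central line it is set to `0` if `a + b ≤ 1`; this makes the function nonnegative everywhere. -/
noncomputable def meshSpline (p q a b c : ℝ) (x : EuclideanSpace ℝ (Fin 2)) : ℝ :=
  1 / q * if 0 < x 1 then sectorValue a b c (x 1 / q) (x 0 - p / q * x 1)
    else if x 1 < 0 then sectorValue b a c (-(x 1 / q)) (x 0 - (p - 1) / q * x 1)
    else if 1 < a + b then centralValue a b c (x 0) else 0

theorem meshSpline_of_pos (p q a b c : ℝ) {x : EuclideanSpace ℝ (Fin 2)} (hx : 0 < x 1) :
    meshSpline p q a b c x = 1 / q * sectorValue a b c (x 1 / q) (x 0 - p / q * x 1) := by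
  rw [meshSpline, if_pos hx]

theorem meshSpline_of_neg (p q a b c : ℝ) {x : EuclideanSpace ℝ (Fin 2)} (hx : x 1 < 0) :
    meshSpline p q a b c x =
      1 / q * sectorValue b a c (-(x 1 / q)) (x 0 - (p - 1) / q * x 1) := by
  rw [meshSpline, if_neg hx.le.not_gt, if_pos hx]

theorem meshSpline_of_eq_zero (p q a b c : ℝ) {x : EuclideanSpace ℝ (Fin 2)} (hx : x 1 = 0) :
    meshSpline p q a b c x = 1 / q * if 1 < a + b then centralValue a b c (x 0) else 0 := by
  rw [meshSpline, if_neg hx.le.not_gt, if_neg hx.ge.not_gt]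

section Mesh

variable {p q a b c : ℝ} (hq : 0 < q) (ha : 0 < a) (hb : 0 < b) (hc : 0 < c)

include hq in
/-- The linear change of coordinates `(s, u) ↦ s x¹ + u x²` has determinant `-q`. -/
theorem lintegral_mesh_coordinates (p : ℝ) {f : EuclideanSpace ℝ (Fin 2) → ENNReal}
    (hf : Measurable f) :
    ∫⁻ s : ℝ, ∫⁻ u : ℝ, f !₂[p * s + (1 - p) * u, q * s - q * u] =
      ENNReal.ofReal q⁻¹ * ∫⁻ x, f x := by
  set M : Matrix (Fin 2) (Fin 2) ℝ := !![p, 1 - p; q, -q] with hM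
  have hdet : M.det = -q := by rw [hM, Matrix.det_fin_two_of]; ring
  have hmap := Real.map_matrix_volume_pi_eq_smul_volume_pi (M := M) (by rw [hdet]; simp [hq.ne'])
  rw [hdet, inv_neg, abs_neg, abs_of_pos (inv_pos.2 hq)] at hmap
  have hmeas : Measurable fun y : Fin 2 → ℝ => f (WithLp.toLp 2 y) :=
    hf.comp (PiLp.volume_preserving_toLp (Fin 2)).measurable
  have hlin : Measurable (Matrix.toLin' M) :=
    (LinearMap.continuous_of_finiteDimensional _).measurable
  rw [← (PiLp.volume_preserving_toLp (Fin 2)).lintegral_comp hf, ← smul_eq_mul,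
    ← lintegral_smul_measure, ← hmap, lintegral_map hmeas hlin, volume_pi]
  refine Eq.symm ((lintegral_pi_fin_two _ (hmeas.comp hlin)).trans ?_)
  refine lintegral_congr fun s => lintegral_congr fun u => ?_
  simp only [Function.comp_apply]
  congr 2
  ext i
  fin_cases i
  · simp [hM, Matrix.mulVec, dotProduct]
  · simp [hM, Matrix.mulVec, dotProduct]; ring

include ha hb hc

theorem measurable_meshSpline (p q : ℝ) : Measurable (meshSpline p q a b c) := by
  have h0 : Measurable fun x : EuclideanSpace ℝ (Fin 2) => x 0 := by fun_prop
  have h1 : Measurable fun x : EuclideanSpace ℝ (Fin 2) => x 1 := by fun_prop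
  have h2 : Measurable fun x : EuclideanSpace ℝ (Fin 2) =>
      sectorValue a b c (x 1 / q) (x 0 - p / q * x 1) :=
    (measurable_sectorValue hb hc a).comp
      ((h1.div_const q).prodMk (h0.sub (h1.const_mul (p / q))))
  have h3 : Measurable fun x : EuclideanSpace ℝ (Fin 2) =>
      sectorValue b a c (-(x 1 / q)) (x 0 - (p - 1) / q * x 1) :=
    (measurable_sectorValue ha hc b).comp
      ((h1.div_const q).neg.prodMk (h0.sub (h1.const_mul ((p - 1) / q))))
  have h4 : Measurable fun x : EuclideanSpace ℝ (Fin 2) =>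
      if 1 < a + b then centralValue a b c (x 0) else 0 := by
    split_ifs
    · exact (((measurable_truncPow _).comp h0).const_mul _).const_mul _
    · exact measurable_const
  exact (Measurable.ite (measurableSet_lt measurable_const h1) h2
    (Measurable.ite (measurableSet_lt h1 measurable_const) h3 h4)).const_mul _

include hq

theorem meshSpline_nonneg (p : ℝ) (x : EuclideanSpace ℝ (Fin 2)) :
    0 ≤ meshSpline p q a b c x := by
  refine mul_nonneg (by positivity) ?_
  split_ifs with h1 h2 h3
  · exact sectorValue_nonneg ha hb hc (by positivity) _
  · exact sectorValue_nonneg hb ha hc (neg_pos.2 (div_neg_of_neg_of_pos h2 hq)) _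
  · exact centralValue_nonneg ha hb hc _
  · exact le_rfl

omit ha hb hc in
theorem meshSpline_of_lt (p a b c : ℝ) {s u : ℝ} (h : u < s) :
    meshSpline p q a b c !₂[p * s + (1 - p) * u, q * s - q * u] =
      1 / q * sectorValue a b c (s - u) u := by
  have h1 : 0 < q * s - q * u := by have := mul_pos hq (sub_pos.2 h); linarith
  have h2 : (q * s - q * u) / q = s - u := by field_simp
  have h3 : p * s + (1 - p) * u - p / q * (q * s - q * u) = u := by field_simp; ring
  refine (meshSpline_of_pos p q a b c h1).trans ?_
  change 1 / q * sectorValue a b c ((q * s - q * u) / q)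
    (p * s + (1 - p) * u - p / q * (q * s - q * u)) = _
  rw [h2, h3]

omit ha hb hc in
theorem meshSpline_of_gt (p a b c : ℝ) {s u : ℝ} (h : s < u) :
    meshSpline p q a b c !₂[p * s + (1 - p) * u, q * s - q * u] =
      1 / q * sectorValue b a c (u - s) s := by
  have h1 : q * s - q * u < 0 := by have := mul_pos hq (sub_pos.2 h); linarith
  have h2 : -((q * s - q * u) / q) = u - s := by field_simp; ring
  have h3 : p * s + (1 - p) * u - (p - 1) / q * (q * s - q * u) = s := by field_simp; ring
  refine (meshSpline_of_neg p q a b c h1).trans ?_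
  change 1 / q * sectorValue b a c (-((q * s - q * u) / q))
    (p * s + (1 - p) * u - (p - 1) / q * (q * s - q * u)) = _
  rw [h2, h3]

theorem lintegral_gammaDensity_eq_meshSpline (p : ℝ) {s u : ℝ} (hs : s ≠ 0) (hu : u ≠ 0)
    (hsu : s ≠ u) :
    ∫⁻ t, gammaDensity c t * (gammaDensity a (s - t) * gammaDensity b (u - t)) =
      ENNReal.ofReal q * ENNReal.ofReal
        (meshSpline p q a b c !₂[p * s + (1 - p) * u, q * s - q * u]) := by
  rw [← ENNReal.ofReal_mul hq.le]
  rcases hsu.lt_or_gt with h | h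
  · simp_rw [mul_comm (gammaDensity a _)]
    rw [meshSpline_of_gt hq p a b c h, lintegral_gammaDensity hb ha hc h hs]
    congr 1
    field_simp
  · rw [meshSpline_of_lt hq p a b c h, lintegral_gammaDensity ha hb hc h hu]
    congr 1
    field_simp

omit ha in
theorem continuousAt_meshSpline_of_pos (p a : ℝ) {x : EuclideanSpace ℝ (Fin 2)} (hx : 0 < x 1)
    (h : x 0 = p / q * x 1 → 1 < b + c) : ContinuousAt (meshSpline p q a b c) x := by
  have c1 : Continuous fun x : EuclideanSpace ℝ (Fin 2) => x 1 := by fun_prop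
  have k1 : Continuous fun x : EuclideanSpace ℝ (Fin 2) =>
      ((x 1 / q, x 0 - p / q * x 1) : ℝ × ℝ) := by fun_prop
  have h1 := continuousAt_sectorValue hb hc a (div_pos hx hq) (u := x 0 - p / q * x 1)
    (or_iff_not_imp_left.2 fun h' => h (sub_eq_zero.1 (not_not.1 h')))
  have h2 : ContinuousAt (fun x : EuclideanSpace ℝ (Fin 2) =>
      1 / q * sectorValue a b c (x 1 / q) (x 0 - p / q * x 1)) x :=
    (h1.tendsto.comp (k1.tendsto x)).const_mul (1 / q)
  refine h2.congr ?_
  filter_upwards [c1.continuousAt.eventually (Ioi_mem_nhds hx)] with z hz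
  exact (meshSpline_of_pos p q a b c hz).symm

omit hb in
theorem continuousAt_meshSpline_of_neg (p b : ℝ) {x : EuclideanSpace ℝ (Fin 2)} (hx : x 1 < 0)
    (h : x 0 = (p - 1) / q * x 1 → 1 < a + c) : ContinuousAt (meshSpline p q a b c) x := by
  have c1 : Continuous fun x : EuclideanSpace ℝ (Fin 2) => x 1 := by fun_prop
  have k1 : Continuous fun x : EuclideanSpace ℝ (Fin 2) =>
      ((-(x 1 / q), x 0 - (p - 1) / q * x 1) : ℝ × ℝ) := by fun_prop
  have h1 := continuousAt_sectorValue ha hc b (neg_pos.2 (div_neg_of_neg_of_pos hx hq))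
    (u := x 0 - (p - 1) / q * x 1)
    (or_iff_not_imp_left.2 fun h' => h (sub_eq_zero.1 (not_not.1 h')))
  have h2 : ContinuousAt (fun x : EuclideanSpace ℝ (Fin 2) =>
      1 / q * sectorValue b a c (-(x 1 / q)) (x 0 - (p - 1) / q * x 1)) x :=
    (h1.tendsto.comp (k1.tendsto x)).const_mul (1 / q)
  refine h2.congr ?_
  filter_upwards [c1.continuousAt.eventually (Iio_mem_nhds hx)] with z hz
  exact (meshSpline_of_neg p q a b c hz).symm

/-- On the central line, the limits in the two open half-planes and along the line agree. -/
theorem continuousAt_meshSpline_of_eq_zero (p : ℝ) {x : EuclideanSpace ℝ (Fin 2)} (hx : x 1 = 0)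
    (h3 : 0 < x 0 → 1 < a + b)
    (h4 : x 0 = 0 → 1 < a + b ∧ 1 ≤ b + c ∧ 1 ≤ a + c ∧ 2 < a + b + c) :
    ContinuousAt (meshSpline p q a b c) x := by
  have k1 : Continuous fun x : EuclideanSpace ℝ (Fin 2) =>
      ((x 1 / q, x 0 - p / q * x 1) : ℝ × ℝ) := by fun_prop
  have k2 : Continuous fun x : EuclideanSpace ℝ (Fin 2) =>
      ((-(x 1 / q), x 0 - (p - 1) / q * x 1) : ℝ × ℝ) := by fun_prop
  set v : ℝ := if 1 < a + b then centralValue a b c (x 0) else 0 with hv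
  have hT1 : Tendsto (meshSpline p q a b c) (𝓝[{z | 0 < z 1}] x) (𝓝 (1 / q * v)) := by
    have hk : Tendsto (fun z : EuclideanSpace ℝ (Fin 2) =>
        ((z 1 / q, z 0 - p / q * z 1) : ℝ × ℝ)) (𝓝[{z | 0 < z 1}] x)
        (𝓝[{z | 0 < z.1}] (0, x 0)) := by
      refine tendsto_nhdsWithin_iff.2 ⟨?_, ?_⟩
      · have := (k1.tendsto x).mono_left (nhdsWithin_le_nhds (s := {z | 0 < z 1}))
        simpa only [hx, zero_div, mul_zero, sub_zero] using this
      · filter_upwards [self_mem_nhdsWithin] with z (hz : 0 < z 1) using div_pos hz hq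
    have h := ((tendsto_sectorValue_centralValue ha hb hc h3 fun h0 =>
      ⟨(h4 h0).1, (h4 h0).2.1, (h4 h0).2.2.2⟩).comp hk).const_mul (1 / q)
    refine h.congr' ?_
    filter_upwards [self_mem_nhdsWithin] with z hz
    exact (meshSpline_of_pos p q a b c hz).symm
  have hT2 : Tendsto (meshSpline p q a b c) (𝓝[{z | z 1 < 0}] x) (𝓝 (1 / q * v)) := by
    have hk : Tendsto (fun z : EuclideanSpace ℝ (Fin 2) =>
        ((-(z 1 / q), z 0 - (p - 1) / q * z 1) : ℝ × ℝ)) (𝓝[{z | z 1 < 0}] x)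
        (𝓝[{z | 0 < z.1}] (0, x 0)) := by
      refine tendsto_nhdsWithin_iff.2 ⟨?_, ?_⟩
      · have := (k2.tendsto x).mono_left (nhdsWithin_le_nhds (s := {z | z 1 < 0}))
        simpa only [hx, zero_div, mul_zero, sub_zero, neg_zero] using this
      · filter_upwards [self_mem_nhdsWithin] with z (hz : z 1 < 0)
          using neg_pos.2 (div_neg_of_neg_of_pos hz hq)
    have h := ((tendsto_sectorValue_centralValue hb ha hc (r := x 0)
      (fun h0 => by linarith [h3 h0]) fun h0 =>
      ⟨by linarith [(h4 h0).1], (h4 h0).2.2.1, by linarith [(h4 h0).2.2.2]⟩).comp hk).const_mul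
      (1 / q)
    rw [add_comm b a, centralValue_comm b a] at h
    refine h.congr' ?_
    filter_upwards [self_mem_nhdsWithin] with z hz
    exact (meshSpline_of_neg p q a b c hz).symm
  have hT3 : Tendsto (fun z : EuclideanSpace ℝ (Fin 2) =>
      1 / q * if 1 < a + b then centralValue a b c (z 0) else 0) (𝓝 x) (𝓝 (1 / q * v)) := by
    refine Tendsto.const_mul _ ?_
    rw [hv]
    by_cases hab : 1 < a + b
    · simp only [if_pos hab]
      have h5 : x 0 ≠ 0 ∨ 0 < a + b + c - 2 :=
        or_iff_not_imp_left.2 fun h => sub_pos.2 (h4 (not_not.1 h)).2.2.2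
      have c0 : Continuous fun x : EuclideanSpace ℝ (Fin 2) => x 0 := by fun_prop
      exact (((continuousAt_truncPow h5).tendsto.comp (c0.tendsto x)).const_mul _).const_mul _
    · simp only [if_neg hab]
      exact tendsto_const_nhds
  rw [ContinuousAt, meshSpline_of_eq_zero p q a b c hx, ← hv]
  intro S hS
  have e1 := mem_nhdsWithin_iff_eventually.1 (hT1 hS)
  have e2 := mem_nhdsWithin_iff_eventually.1 (hT2 hS)
  change ∀ᶠ z in 𝓝 x, meshSpline p q a b c z ∈ S
  filter_upwards [e1, e2, hT3 hS] with z hz1 hz2 hz3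
  rcases lt_trichotomy (z 1) 0 with h | h | h
  · exact hz2 h
  · rw [meshSpline_of_eq_zero p q a b c h]
    exact hz3
  · exact hz1 h

end Mesh

section Spline

variable {X : Fin 3 → EuclideanSpace ℝ (Fin 2)} {α : Fin 3 → ℝ}

theorem mesh_sum_smul (hX : X 2 = X 0 + X 1) (hX3 : X 2 = !₂[(1 : ℝ), 0]) (t : Fin 3 → ℝ) :
    ∑ k, t k • X k = !₂[X 0 0 * (t 0 + t 2) + (1 - X 0 0) * (t 1 + t 2),
      X 0 1 * (t 0 + t 2) - X 0 1 * (t 1 + t 2)] := by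
  have h0 : X 0 0 + X 1 0 = 1 := by
    have := congrArg (fun v : EuclideanSpace ℝ (Fin 2) => v 0) (hX.symm.trans hX3)
    simpa using this
  have h1 : X 0 1 + X 1 1 = 0 := by
    have := congrArg (fun v : EuclideanSpace ℝ (Fin 2) => v 1) (hX.symm.trans hX3)
    simpa using this
  ext i
  fin_cases i
  · simp [Fin.sum_univ_three, hX3]
    linear_combination (t 1) * h0
  · simp [Fin.sum_univ_three, hX3]
    linear_combination (t 1) * h1

/-- The cone spanned by the mesh is pointed. -/
theorem exists_mul_norm_le_mesh (hX : X 2 = X 0 + X 1) (hX3 : X 2 = !₂[(1 : ℝ), 0])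
    (hq : 0 < X 0 1) :
    ∃ κ : ℝ, 0 < κ ∧ ∀ t : Fin 3 → ℝ, (∀ k, 0 ≤ t k) → κ * ‖t‖ ≤ ‖∑ k, t k • X k‖ := by
  set p := X 0 0 with hp
  set q := X 0 1 with hq'
  -- `s = t₀ + t₂` and `u = t₁ + t₂` are recovered from `x` with coefficients bounded by `D`
  set D : ℝ := 1 + (|p| + |p - 1|) / q with hD
  have hD0 : 0 < D := by positivity
  refine ⟨D⁻¹, inv_pos.2 hD0, fun t ht => ?_⟩
  rw [inv_mul_le_iff₀ hD0]
  set x := ∑ k, t k • X k with hx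
  have hxe := mesh_sum_smul hX hX3 t
  have hx0 : x 0 = p * (t 0 + t 2) + (1 - p) * (t 1 + t 2) := by rw [hx, hxe]; rfl
  have hx1 : x 1 = q * (t 0 + t 2) - q * (t 1 + t 2) := by rw [hx, hxe]; rfl
  have n0 : |x 0| ≤ ‖x‖ := PiLp.norm_apply_le x 0
  have n1 : |x 1| ≤ ‖x‖ := PiLp.norm_apply_le x 1
  have key : ∀ e : ℝ, |e| ≤ |p| + |p - 1| → x 0 - e / q * x 1 ≤ D * ‖x‖ := by
    intro e he
    have h1 : |e / q * x 1| ≤ (|p| + |p - 1|) / q * ‖x‖ := by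
      rw [abs_mul, abs_div, abs_of_pos hq]
      gcongr
    have h2 := neg_abs_le (e / q * x 1)
    have h3 := le_abs_self (x 0)
    rw [hD]
    linarith
  have hs : t 0 + t 2 ≤ D * ‖x‖ := by
    refine le_trans (le_of_eq ?_) (key (p - 1) (by linarith [abs_nonneg p]))
    rw [hx0, hx1]; field_simp; ring
  have hu : t 1 + t 2 ≤ D * ‖x‖ := by
    refine le_trans (le_of_eq ?_) (key p (by linarith [abs_nonneg (p - 1)]))
    rw [hx0, hx1]; field_simp; ring
  refine (pi_norm_le_iff_of_nonneg (by positivity)).2 fun k => ?_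
  rw [Real.norm_of_nonneg (ht k)]
  have := ht 0
  have := ht 1
  have := ht 2
  fin_cases k
  · simp only [Fin.zero_eta]; linarith
  · simp only [Fin.mk_one]; linarith
  · simp only [Fin.reduceFinMk]; linarith

theorem coneMeasure_eq_withDensity (hX : X 2 = X 0 + X 1) (hX3 : X 2 = !₂[(1 : ℝ), 0])
    (hq : 0 < X 0 1) (hα : ∀ k, 0 < α k) :
    coneMeasure X α = volume.withDensity fun x =>
      ENNReal.ofReal (meshSpline (X 0 0) (X 0 1) (α 0) (α 1) (α 2) x) := by
  set p := X 0 0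
  set q := X 0 1
  have hC := (measurable_meshSpline (hα 0) (hα 1) (hα 2) p q).ennreal_ofReal
  refine Measure.ext_of_lintegral _ fun f hf => ?_
  set φ : ℝ × ℝ → EuclideanSpace ℝ (Fin 2) :=
    fun z => !₂[p * z.1 + (1 - p) * z.2, q * z.1 - q * z.2] with hφ
  have hφm : Measurable φ := by fun_prop
  rw [coneMeasure, lintegral_map hf (measurable_sum_smul X)]
  simp_rw [mesh_sum_smul hX hX3]
  rw [lintegral_withDensity_eq_lintegral_mul _ hC hf]
  refine (lintegral_gammaWeight_shear α (f := fun z => f (φ z)) (hf.comp hφm)).trans ?_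
  have hrw : ∀ s : ℝ, s ≠ 0 → (∫⁻ u, f (φ (s, u)) * ∫⁻ t, gammaDensity (α 2) t *
      (gammaDensity (α 0) (s - t) * gammaDensity (α 1) (u - t))) =
      ENNReal.ofReal q * ∫⁻ u, (ENNReal.ofReal (meshSpline p q (α 0) (α 1) (α 2) (φ (s, u))) *
        f (φ (s, u))) := by
    intro s hs
    rw [← lintegral_const_mul]
    · refine lintegral_congr_ae ?_
      filter_upwards [Measure.ae_ne volume (0 : ℝ), Measure.ae_ne volume s] with u hu0 hus
      rw [lintegral_gammaDensity_eq_meshSpline hq (hα 0) (hα 1) (hα 2) p hs hu0 hus.symm]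
      ring
    · exact ((hC.mul hf).comp hφm).comp (by fun_prop : Measurable fun u : ℝ => (s, u))
  have h1 : (∫⁻ s, ∫⁻ u, f (φ (s, u)) * ∫⁻ t, gammaDensity (α 2) t *
      (gammaDensity (α 0) (s - t) * gammaDensity (α 1) (u - t))) =
      ∫⁻ s, ENNReal.ofReal q * ∫⁻ u,
        (ENNReal.ofReal (meshSpline p q (α 0) (α 1) (α 2) (φ (s, u))) * f (φ (s, u))) := by
    refine lintegral_congr_ae ?_
    filter_upwards [Measure.ae_ne volume (0 : ℝ)] with s hs using hrw s hs
  have hm : Measurable fun z : ℝ × ℝ =>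
      ENNReal.ofReal (meshSpline p q (α 0) (α 1) (α 2) (φ z)) * f (φ z) := (hC.mul hf).comp hφm
  rw [h1, lintegral_const_mul _ hm.lintegral_prod_right']
  have h2 := lintegral_mesh_coordinates hq p (hC.mul hf)
  simp only [Pi.mul_apply] at h2
  rw [hφ, h2, ← mul_assoc, ← ENNReal.ofReal_mul hq.le, mul_inv_cancel₀ hq.ne', ENNReal.ofReal_one,
    one_mul]
  rfl

end Spline

/-- A measure of temperate growth with a nonnegative density is represented by that density. -/
theorem isRepresentedBy_of_withDensity {s : ℕ} {μ : Measure (EuclideanSpace ℝ (Fin s))}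
    [μ.HasTemperateGrowth] {f : EuclideanSpace ℝ (Fin s) → ℝ} (hf : Measurable f)
    (hf0 : ∀ x, 0 ≤ f x) (hμ : μ = volume.withDensity fun x => ENNReal.ofReal (f x)) :
    IsRepresentedBy μ.toTemperedDistribution f := by
  intro g
  have hlt : ∀ᵐ x : EuclideanSpace ℝ (Fin s), ENNReal.ofReal (f x) < ⊤ :=
    Eventually.of_forall fun _ => ENNReal.ofReal_lt_top
  have hmul : ∀ x, (ENNReal.ofReal (f x)).toReal • g x = g x * (f x : ℂ) := fun x => by
    rw [ENNReal.toReal_ofReal (hf0 x), Complex.real_smul, mul_comm]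
  have hint : Integrable g μ := g.integrable
  constructor
  · rw [hμ, integrable_withDensity_iff_integrable_smul' hf.ennreal_ofReal hlt] at hint
    simpa only [hmul] using hint
  · change ∫ x, g x ∂μ = _
    rw [hμ, integral_withDensity_eq_integral_toReal_smul hf.ennreal_ofReal hlt]
    simp only [hmul]

theorem mainTheorem3 (X : Fin 3 → EuclideanSpace ℝ (Fin 2)) (hX : IsThreeDirectionalMesh X)
    (hX3 : X 2 = !₂[(1 : ℝ), 0]) (hX12 : 0 < X 0 1)
    (α : Fin 3 → ℝ) (hα : ∀ k, 0 < α k) :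
    -- the fractional cone spline exists as a tempered distribution
    IsFracConeSpline X α (fracConeSpline X α) ∧
    -- the series that occurs on the line `x₂ = 0` converges
    (Summable fun k : ℕ =>
      (-1 : ℝ) ^ k / (k.factorial * Real.Gamma (α 2 - k) * (α 0 + α 1 + k - 1))) ∧
    -- the spline is the following function
    ∃ C : EuclideanSpace ℝ (Fin 2) → ℝ,
      IsRepresentedBy (fracConeSpline X α) C ∧
      (∀ x, 0 < x 1 → C x = 1 / X 0 1 *
        (1 / (Real.Gamma (α 0) * Real.Gamma (α 1 + α 2)) * (x 1 / X 0 1) ^ (α 0 - 1) *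
          truncPow (x 0 - X 0 0 / X 0 1 * x 1) (α 1 + α 2 - 1) *
          gaussHypergeometric (1 - α 0) (α 1) (α 1 + α 2)
            (-((x 0 - X 0 0 / X 0 1 * x 1) / (x 1 / X 0 1))))) ∧
      (∀ x, x 1 < 0 → C x = 1 / X 0 1 *
        (1 / (Real.Gamma (α 1) * Real.Gamma (α 0 + α 2)) * (-(x 1 / X 0 1)) ^ (α 1 - 1) *
          truncPow (x 0 - (X 0 0 - 1) / X 0 1 * x 1) (α 0 + α 2 - 1) *
          gaussHypergeometric (1 - α 1) (α 0) (α 0 + α 2)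
            ((x 0 - (X 0 0 - 1) / X 0 1 * x 1) / (x 1 / X 0 1)))) ∧
      (∀ x, x 1 = 0 → 1 < α 0 + α 1 → C x = 1 / X 0 1 *
        (1 / (Real.Gamma (α 0) * Real.Gamma (α 1)) *
          (∑' k : ℕ, (-1 : ℝ) ^ k /
            (k.factorial * Real.Gamma (α 2 - k) * (α 0 + α 1 + k - 1))) *
          truncPow (x 0) (α 0 + α 1 + α 2 - 2))) ∧
      (∀ x, x 1 = 0 → x 0 < 0 → C x = 0) ∧
      -- and `C x` is the pointwise value of the spline: `C` is continuous off the
      -- singular rays, in particular on the null set `x₂ = 0` when `α₁ + α₂ > 1`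
      (∀ x, (0 < x 1 → x 0 = X 0 0 / X 0 1 * x 1 → 1 < α 1 + α 2) →
        (x 1 < 0 → x 0 = (X 0 0 - 1) / X 0 1 * x 1 → 1 < α 0 + α 2) →
        (x 1 = 0 → 0 < x 0 → 1 < α 0 + α 1) →
        (x 1 = 0 → x 0 = 0 → 1 < α 0 + α 1 ∧ 1 ≤ α 1 + α 2 ∧ 1 ≤ α 0 + α 2 ∧
          2 < α 0 + α 1 + α 2) →
        ContinuousAt C x) := by
  obtain ⟨-, hX2⟩ := hX
  obtain ⟨κ, hκ, hle⟩ := exists_mul_norm_le_mesh hX2 hX3 hX12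
  have htemp := coneMeasure_hasTemperateGrowth hα hκ hle
  have hspline := isFracConeSpline_coneMeasure (X := X) hα
  have hdens := coneMeasure_eq_withDensity hX2 hX3 hX12 hα
  have hT := fracConeSpline_eq hspline
  have hterm : ∀ k : ℕ, (-1 : ℝ) ^ k /
      (k.factorial * Real.Gamma (α 2 - k) * (α 0 + α 1 + k - 1)) =
      (-1 : ℝ) ^ k / (k.factorial * Real.Gamma (α 2 - k) * (α 0 + α 1 - 1 + k)) := fun k => by
    rw [show α 0 + α 1 + (k : ℝ) - 1 = α 0 + α 1 - 1 + k by ring]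
  have h0 := hα 0
  have h1 := hα 1
  have h2 := hα 2
  simp only [hterm]
  refine ⟨hT ▸ hspline, summable_centralTerm h2 _,
    meshSpline (X 0 0) (X 0 1) (α 0) (α 1) (α 2), ?_, ?_, ?_, ?_, ?_, ?_⟩
  · rw [hT]
    exact isRepresentedBy_of_withDensity (measurable_meshSpline h0 h1 h2 _ _)
      (meshSpline_nonneg hX12 h0 h1 h2 _) hdens
  · intro x hx
    exact meshSpline_of_pos _ _ _ _ _ hx
  · intro x hx
    rw [meshSpline_of_neg _ _ _ _ _ hx, sectorValue, div_neg, neg_neg]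
  · intro x hx hab
    rw [meshSpline_of_eq_zero _ _ _ _ _ hx, if_pos hab, tsum_centralTerm h2 (by linarith),
      centralValue]
    ring
  · intro x hx hx0
    rw [meshSpline_of_eq_zero _ _ _ _ _ hx]
    simp [centralValue, truncPow_of_neg hx0]
  · intro x g1 g2 g3 g4
    rcases lt_trichotomy (x 1) 0 with hx | hx | hx
    · exact continuousAt_meshSpline_of_neg hX12 h0 h2 _ _ hx (g2 hx)
    · exact continuousAt_meshSpline_of_eq_zero hX12 h0 h1 h2 _ hx (g3 hx) (g4 hx)
    · exact continuousAt_meshSpline_of_pos hX12 h1 h2 _ _ hx (g1 hx)
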